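/- Let $d\ge 1$ and let $(X(t))_{t\in\mathbb{R}^d}$ be a (strictly) stationary, jointly measurable real-valued random field on a probability space $(\Omega,\mathcal A,\mathbb P)$. For sub-$\sigma$-algebras $\mathcal F,\mathcal G\subseteq\mathcal A$ put $$\alpha(\mathcal F,\mathcal G)=\sup\{|\mathbb P(F\cap G)-\mathbb P(F)\mathbb P(G)| : F\in\mathcal F,\ G\in\mathcal G\}.$$ Let $B^d$ be the closed Euclidean unit ball in $\mathbb{R}^d$, $\lambda_d$ Lebesgue measure and $\kappa_d=\lambda_d(B^d)$. For $r\ge 0$ and $\gamma\ge 2\kappa_d$ let $\alpha_\gamma(r)$ be the supremum of $\alpha(\sigma(X(t):t\in I),\sigma(X(t):t\in J))$ over all $I,J\subseteq\mathbb{R}^d$ with $\lambda_d((I\cup J)+B^d)\le\gamma$ for which there is a unit vector $u$ with $\min_{t\in I}\langle u,t\rangle-\max_{t\in J}\langle u,t\rangle>r$. Assume that there are $n\in\mathbb{N}$, $\delta>4$ and $C,l>0$ with $$\frac nd>\max\Big\{l+\frac{\delta}{\delta-2},\ \frac{\delta}{\delta-4},\ 3\Big\}$$ such that $\alpha_\gamma(r)\le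 C r^{-n}\gamma^l$ for all $\gamma\ge 2\kappa_d$ and $r>0$, and that $\mathbb{E}|X(0)|^\delta<\infty$. Let $V$ be the vector space of all Lipschitz continuous functions $f:\mathbb{R}\to\mathbb{R}$ with the norm $\|f\|=\operatorname{Lip} f+|f(0)|$, where $\operatorname{Lip} f=\sup_{x\ne y}|f(x)-f(y)|/|x-y|$. Then for all $f,g\in V$ the function $t\mapsto\operatorname{Cov}(f(X(0)),g(X(t)))$ is Lebesgue integrable on $\mathbb{R}^d$, and there is a centered Gaussian process $\Phi=(\Phi(f))_{f\in V}$ on some probability space with $$\operatorname{Cov}(\Phi(f),\Phi(g))=\int_{\mathbb{R}^d}\operatorname{Cov}\big(f(X(0)),g(X(t))\big)\,dt,\qquad f,g\in V.$$ Moreover, every such process $\Phi$, on any probability space, has a version whose paths are linear and continuous: there is a process $\Psi=(\Psi(f))_{f\in V}$ on the same probability space with $\Psi(f)=\Phi(f)$ almost surely for every $f\in V$, such that for every $\omega$ the map $f\mapsto\Psi(f)(\omega)$ is linear and continuous on $(V,\|\cdot\|)$. -/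

import Mathlib

open MeasureTheory ProbabilityTheory
open scoped Pointwise

noncomputable section

/-! ### The normed space of Lipschitz functions -/

/-- The Lipschitz continuous functions `ℝ → ℝ`, as a linear subspace of all functions. -/
def lipSubmodule : Submodule ℝ (ℝ → ℝ) where
  carrier := {f | ∃ K : NNReal, LipschitzWith K f}
  zero_mem' := ⟨0, LipschitzWith.const 0⟩
  add_mem' := by
    rintro f g ⟨K, hK⟩ ⟨L, hL⟩
    exact ⟨K + L, hK.add hL⟩
  smul_mem' := by
    rintro c f ⟨K, hK⟩
    exact ⟨‖c‖₊ * K, (lipschitzWith_smul c).comp hK⟩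

/-- The vector space `V` of all Lipschitz continuous functions `ℝ → ℝ`. It is a separate type, so
that it does not inherit the topology of pointwise convergence from `ℝ → ℝ`. -/
def LipSpace : Type := lipSubmodule

namespace LipSpace

instance : AddCommGroup LipSpace := inferInstanceAs (AddCommGroup lipSubmodule)

instance : Module ℝ LipSpace := inferInstanceAs (Module ℝ lipSubmodule)

instance : CoeFun LipSpace (fun _ => ℝ → ℝ) := ⟨fun f => f.1⟩

/-- The Lipschitz constant `sup_{x ≠ y} |f x - f y| / |x - y|`. -/
def lip (f : LipSpace) : ℝ := sSup {r : ℝ | ∃ x y : ℝ, x ≠ y ∧ r = |f x - f y| / |x - y|}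

/-- The norm `‖f‖ = Lip f + |f 0|`. -/
instance : Norm LipSpace := ⟨fun f => f.lip + |f 0|⟩

theorem norm_def (f : LipSpace) : ‖f‖ = f.lip + |f 0| := rfl

theorem bddAbove_quot (f : LipSpace) :
    BddAbove {r : ℝ | ∃ x y : ℝ, x ≠ y ∧ r = |f x - f y| / |x - y|} := by
  obtain ⟨K, hK⟩ := f.2
  refine ⟨K, ?_⟩
  rintro r ⟨x, y, hxy, rfl⟩
  have h := hK.dist_le_mul x y
  rw [Real.dist_eq, Real.dist_eq] at h
  exact (div_le_iff₀ (abs_pos.2 (sub_ne_zero.2 hxy))).2 h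

theorem lip_nonneg (f : LipSpace) : 0 ≤ f.lip := by
  refine Real.sSup_nonneg ?_
  rintro r ⟨x, y, -, rfl⟩
  positivity

theorem abs_sub_le_lip (f : LipSpace) (x y : ℝ) : |f x - f y| ≤ f.lip * |x - y| := by
  by_cases hxy : x = y
  · subst hxy
    simp
  · exact (div_le_iff₀ (abs_pos.2 (sub_ne_zero.2 hxy))).1
      (le_csSup f.bddAbove_quot ⟨x, y, hxy, rfl⟩)

theorem lip_le (f : LipSpace) {K : ℝ} (h : ∀ x y : ℝ, |f x - f y| ≤ K * |x - y|) :
    f.lip ≤ K := by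
  refine csSup_le ⟨_, 0, 1, zero_ne_one, rfl⟩ ?_
  rintro r ⟨x, y, hxy, rfl⟩
  exact (div_le_iff₀ (abs_pos.2 (sub_ne_zero.2 hxy))).2 (h x y)

theorem add_apply (f g : LipSpace) (x : ℝ) : (f + g) x = f x + g x := rfl

theorem smul_apply (c : ℝ) (f : LipSpace) (x : ℝ) : (c • f) x = c * f x := rfl

theorem norm_smul_le' (c : ℝ) (f : LipSpace) : ‖c • f‖ ≤ |c| * ‖f‖ := by
  have h : (c • f).lip ≤ |c| * f.lip := by
    refine lip_le _ fun x y => ?_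
    rw [smul_apply, smul_apply, ← mul_sub, abs_mul, mul_assoc]
    exact mul_le_mul_of_nonneg_left (abs_sub_le_lip f x y) (abs_nonneg c)
  rw [norm_def, norm_def, smul_apply, abs_mul, mul_add]
  gcongr

theorem normCore : NormedSpace.Core ℝ LipSpace where
  norm_nonneg f := add_nonneg f.lip_nonneg (abs_nonneg _)
  norm_smul c f := by
    rw [Real.norm_eq_abs]
    refine le_antisymm (norm_smul_le' c f) ?_
    by_cases hc : c = 0
    · subst hc
      rw [abs_zero, zero_mul]
      exact add_nonneg (lip_nonneg _) (abs_nonneg _)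
    · have h := norm_smul_le' c⁻¹ (c • f)
      rw [smul_smul, inv_mul_cancel₀ hc, one_smul, abs_inv] at h
      rwa [← div_eq_inv_mul, le_div_iff₀ (abs_pos.2 hc), mul_comm] at h
  norm_triangle f g := by
    have h : (f + g).lip ≤ f.lip + g.lip := by
      refine lip_le _ fun x y => ?_
      have e : (f + g) x - (f + g) y = (f x - f y) + (g x - g y) := by
        rw [add_apply, add_apply]
        ring
      rw [e, add_mul]
      exact (abs_add_le _ _).trans (add_le_add (abs_sub_le_lip f x y) (abs_sub_le_lip g x y))
    have h0 : |(f + g) 0| ≤ |f 0| + |g 0| := abs_add_le _ _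
    rw [norm_def, norm_def, norm_def]
    linarith
  norm_eq_zero_iff f := by
    constructor
    · intro h
      rw [norm_def] at h
      have h1 : f.lip = 0 := by linarith [f.lip_nonneg, abs_nonneg (f 0)]
      have h2 : f 0 = 0 := abs_eq_zero.1 (by linarith)
      refine Subtype.ext (funext fun x => ?_)
      have h3 := abs_sub_le_lip f x 0
      rw [h1, zero_mul, h2, sub_zero] at h3
      exact abs_nonpos_iff.1 h3
    · rintro rfl
      refine le_antisymm ?_ (add_nonneg (lip_nonneg _) (abs_nonneg _))
      have h := norm_smul_le' 0 (0 : LipSpace)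
      rwa [zero_smul, abs_zero, zero_mul] at h

instance : NormedAddCommGroup LipSpace := NormedAddCommGroup.ofCore normCore

instance : NormedSpace ℝ LipSpace := NormedSpace.ofCore normCore

end LipSpace

/-! ### Random fields and mixing -/

section RandomField

variable {Ω : Type*} [MeasurableSpace Ω] {d : ℕ}

/-- Strict stationarity: the finite-dimensional distributions are translation invariant. -/
def IsStationaryField (P : Measure Ω) (X : EuclideanSpace ℝ (Fin d) → Ω → ℝ) : Prop :=
  ∀ (k : ℕ) (t : Fin k → EuclideanSpace ℝ (Fin d)) (h : EuclideanSpace ℝ (Fin d)),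
    P.map (fun ω i => X (t i + h) ω) = P.map (fun ω i => X (t i) ω)

/-- The `α`-mixing coefficient `sup |P (F ∩ G) - P F * P G|` of two `σ`-algebras. -/
def alphaCoeff (P : Measure Ω) (𝓕 𝓖 : MeasurableSpace Ω) : ℝ :=
  sSup {a : ℝ | ∃ F G : Set Ω, MeasurableSet[𝓕] F ∧ MeasurableSet[𝓖] G ∧
    a = |P.real (F ∩ G) - P.real F * P.real G|}

/-- The `σ`-algebra generated by the random variables `X t`, `t ∈ I`. -/
abbrev sigmaField (X : EuclideanSpace ℝ (Fin d) → Ω → ℝ) (I : Set (EuclideanSpace ℝ (Fin d))) :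
    MeasurableSpace Ω :=
  ⨆ t ∈ I, MeasurableSpace.comap (X t) (borel ℝ)

/-- The closed Euclidean unit ball. -/
def unitBall (d : ℕ) : Set (EuclideanSpace ℝ (Fin d)) := Metric.closedBall 0 1

/-- The volume of the closed Euclidean unit ball. -/
def kappa (d : ℕ) : ℝ := (volume : Measure (EuclideanSpace ℝ (Fin d))).real (unitBall d)

/-- The index sets `I` and `J` lie in half-spaces separated by a strip of width larger than `r`:
`min_{t ∈ I} ⟪u, t⟫ - max_{t ∈ J} ⟪u, t⟫ > r` for some unit vector `u`. -/
def StripSeparated (I J : Set (EuclideanSpace ℝ (Fin d))) (r : ℝ) : Prop :=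
  ∃ u : EuclideanSpace ℝ (Fin d), ‖u‖ = 1 ∧ ∃ a b : ℝ,
    IsLeast ((fun t => inner ℝ u t) '' I) a ∧ IsGreatest ((fun t => inner ℝ u t) '' J) b ∧
      r < a - b

/-- The mixing coefficient `α_γ(r)` of a random field. -/
def alphaMixing (P : Measure Ω) (X : EuclideanSpace ℝ (Fin d) → Ω → ℝ) (γ r : ℝ) : ℝ :=
  sSup {a : ℝ | ∃ I J : Set (EuclideanSpace ℝ (Fin d)), StripSeparated I J r ∧
    volume ((I ∪ J) + unitBall d) ≤ ENNReal.ofReal γ ∧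
    a = alphaCoeff P (sigmaField X I) (sigmaField X J)}

/-- The integrated covariance `∫ Cov(f(X(0)), g(X(t))) dt`. -/
def asymCov (P : Measure Ω) (X : EuclideanSpace ℝ (Fin d) → Ω → ℝ) (f g : LipSpace) : ℝ :=
  ∫ t : EuclideanSpace ℝ (Fin d), cov[fun ω => f (X 0 ω), fun ω => g (X t ω); P]

end RandomField

/-! ### Gaussian processes on the Lipschitz space -/

/-- `Φ` is a centered Gaussian process indexed by the Lipschitz space, with covariance
function `K`. -/
structure IsCenteredGaussianOn {Ω : Type*} [MeasurableSpace Ω] (P : Measure Ω)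
    (K : LipSpace → LipSpace → ℝ) (Φ : LipSpace → Ω → ℝ) : Prop where
  measurable : ∀ f, Measurable (Φ f)
  gaussian : IsGaussianProcess Φ P
  centered : ∀ f, ∫ ω, Φ f ω ∂P = 0
  cov_eq : ∀ f g, cov[Φ f, Φ g; P] = K f g

/-- `Ψ` is a version (modification) of `Φ`: for every `f`, almost surely `Ψ f = Φ f`. -/
def IsVersion {Ω : Type*} [MeasurableSpace Ω] (P : Measure Ω) (Ψ Φ : LipSpace → Ω → ℝ) : Prop :=
  (∀ f, Measurable (Ψ f)) ∧ ∀ f, Ψ f =ᵐ[P] Φ f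

end

open MeasureTheory ProbabilityTheory
open scoped Pointwise

noncomputable section

/-! ### Covariance inequalities under mixing -/

/-! Covariances are controlled by fourth moments. If all events generated by `ξ` and `η` have
dependence at most `a`, then truncation gives `|cov[ξ, η]| ≤ 6 √a √(E ξ⁴ + E η⁴)`
(`abs_covariance_le_sqrt`). For the pair `X 0`, `X t` the mixing rate allows `a` of order `(1 + ‖t‖)
^ (-n)`, and its square root is integrable on `ℝ^d` because `n > 2d`. Hence the covariance integral
converges and defines a symmetric bilinear form `B` on `LipSpace` with `B f f ≤ const * √(E (f (X 0)
- c)⁴)` for every constant `c` (`asymCov_self_le`).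

The form is positive semidefinite: against a Gaussian weight in the lag, the integral is a positive
multiple of the second moment of a smoothed field, and the weight can be flattened to `1`. A
Gaussian process with covariance `B` is then the isonormal process of the Hilbert completion of
`(LipSpace, B)`.

For regular paths, `f` is expanded up to constants in the Faber–Schauder system of integer hinges
and dyadic tents. The coefficients are bounded by `‖f‖` on hinges and `2⁻ᵏ ‖f‖` on tents of level
`k`, so `∑ cᵢ(f) Φ(eᵢ)` is almost surely a bounded linear functional of `f` once `∑ wᵢ √(B eᵢ eᵢ)`
is finite (`exists_version`). Since `√(B e e)` is at most a constant times the fourth root of the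
probability that `X 0` meets the support of `e` (for negative hinges, of `e - 1`), Jensen's
inequality over the `2ᵏ` tents above `[i, i + 1)` yields terms `2^(-k/4) (1 + |i|)^(-δ/4)`. These
are summable because `δ > 4`. -/

theorem integral_Ioc_indicator_lt {x M : ℝ} (hx : 0 ≤ x) (hxM : x ≤ M) :
    ∫ u in Set.Ioc 0 M, (if u < x then (1 : ℝ) else 0) = x := by
  have h : (fun u : ℝ => if u < x then (1 : ℝ) else 0) = (Set.Iio x).indicator 1 := by
    ext u
    simp [Set.indicator_apply]
  have h2 : Set.Iio x ∩ Set.Ioc 0 M = Set.Ioo 0 x := by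
    ext u
    simp only [Set.mem_inter_iff, Set.mem_Iio, Set.mem_Ioc, Set.mem_Ioo]
    constructor
    · rintro ⟨a, b, -⟩
      exact ⟨b, a⟩
    · rintro ⟨a, b⟩
      exact ⟨b, a, by linarith⟩
  rw [h, integral_indicator_one measurableSet_Iio, measureReal_restrict_apply measurableSet_Iio, h2]
  simp [hx]

theorem integrable_pow_four {Ω : Type*} [MeasurableSpace Ω] {P : Measure Ω} {ξ : Ω → ℝ} (hξ : MemLp ξ 4 P) :
    Integrable (fun ω => ξ ω ^ 4) P := by
  have := hξ.integrable_norm_pow (p := 4) (by norm_num)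
  simpa [Even.pow_abs (n := 4) (by decide)] using this

section CovarianceInequality

variable {Ω : Type*} [MeasurableSpace Ω] {P : Measure Ω} [IsProbabilityMeasure P]

/-- Hoeffding's identity: writing both variables as layer-cake integrals and applying Fubini, the
covariance is the integral over `[0, M]²` of `P(ξ > u, η > v) - P(ξ > u) P(η > v)`, and each value
is at most `a` in modulus. -/
theorem abs_integral_mul_sub_le_of_mem_Icc {ξ η : Ω → ℝ} (hξ : Measurable ξ) (hη : Measurable η)
    {M a : ℝ} (hξ0 : ∀ ω, 0 ≤ ξ ω) (hξM : ∀ ω, ξ ω ≤ M) (hη0 : ∀ ω, 0 ≤ η ω)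
    (hηM : ∀ ω, η ω ≤ M)
    (ha : ∀ u v : ℝ, |P.real ({ω | u < ξ ω} ∩ {ω | v < η ω}) -
      P.real {ω | u < ξ ω} * P.real {ω | v < η ω}| ≤ a) :
    |∫ ω, ξ ω * η ω ∂P - (∫ ω, ξ ω ∂P) * ∫ ω, η ω ∂P| ≤ a * M ^ 2 := by
  have hM : 0 ≤ M := by
    obtain ⟨ω⟩ := P.nonempty_of_neZero
    exact (hξ0 ω).trans (hξM ω)
  set ν : Measure ℝ := volume.restrict (Set.Ioc 0 M) with hν
  set I : (Ω → ℝ) → ℝ → Ω → ℝ := fun ζ u ω => if u < ζ ω then 1 else 0 with hI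
  have hset : ∀ ζ : Ω → ℝ, Measurable ζ → ∀ u, MeasurableSet {ω | u < ζ ω} := fun ζ hζ u =>
    measurableSet_lt measurable_const hζ
  have hIm : ∀ ζ : Ω → ℝ, Measurable ζ → Measurable (fun p : Ω × ℝ => I ζ p.2 p.1) := by
    intro ζ hζ
    exact Measurable.ite (measurableSet_lt measurable_snd (hζ.comp measurable_fst))
      measurable_const measurable_const
  have hI1 : ∀ ζ u ω, ‖I ζ u ω‖ ≤ 1 := by
    intro ζ u ω
    simp only [hI]
    split_ifs <;> simp
  have hrep : ∀ ζ : Ω → ℝ, (∀ ω, 0 ≤ ζ ω) → (∀ ω, ζ ω ≤ M) → ∀ ω, ∫ u, I ζ u ω ∂ν = ζ ω :=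
    fun ζ h0 h1 ω => integral_Ioc_indicator_lt (h0 ω) (h1 ω)
  have hE : ∀ ζ : Ω → ℝ, Measurable ζ → (∀ ω, 0 ≤ ζ ω) → (∀ ω, ζ ω ≤ M) →
      ∫ ω, ζ ω ∂P = ∫ u, P.real {ω | u < ζ ω} ∂ν := by
    intro ζ hζ h0 h1
    calc ∫ ω, ζ ω ∂P = ∫ ω, ∫ u, I ζ u ω ∂ν ∂P := by simp_rw [hrep ζ h0 h1]
      _ = ∫ u, ∫ ω, I ζ u ω ∂P ∂ν := by
        refine integral_integral_swap (f := fun ω u => I ζ u ω) ?_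
        exact Integrable.of_bound (hIm ζ hζ).aestronglyMeasurable 1
          (Filter.Eventually.of_forall fun p => hI1 _ _ _)
      _ = _ := by
        refine integral_congr_ae (Filter.Eventually.of_forall fun u => ?_)
        have : I ζ u = {ω | u < ζ ω}.indicator 1 := by
          ext ω
          simp [hI, Set.indicator_apply]
        simp only [this]
        rw [integral_indicator_one (hset ζ hζ u)]
  have hEE : ∫ ω, ξ ω * η ω ∂P =
      ∫ p : ℝ × ℝ, P.real ({ω | p.1 < ξ ω} ∩ {ω | p.2 < η ω}) ∂(ν.prod ν) := by
    calc ∫ ω, ξ ω * η ω ∂P = ∫ ω, ∫ p : ℝ × ℝ, I ξ p.1 ω * I η p.2 ω ∂(ν.prod ν) ∂P := by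
          refine integral_congr_ae (Filter.Eventually.of_forall fun ω => ?_)
          simp only
          rw [integral_prod_mul (fun u => I ξ u ω) (fun u => I η u ω), hrep ξ hξ0 hξM,
            hrep η hη0 hηM]
      _ = ∫ p : ℝ × ℝ, ∫ ω, I ξ p.1 ω * I η p.2 ω ∂P ∂(ν.prod ν) := by
        refine integral_integral_swap (f := fun ω (p : ℝ × ℝ) => I ξ p.1 ω * I η p.2 ω) ?_
        refine Integrable.of_bound (Measurable.aestronglyMeasurable ?_) 1
          (Filter.Eventually.of_forall fun p => ?_)
        · exact ((hIm ξ hξ).comp (measurable_fst.prodMk (measurable_fst.comp measurable_snd))).mul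
            ((hIm η hη).comp (measurable_fst.prodMk (measurable_snd.comp measurable_snd)))
        · simp only [Function.uncurry, norm_mul]
          exact mul_le_one₀ (hI1 _ _ _) (norm_nonneg _) (hI1 _ _ _)
      _ = _ := by
        refine integral_congr_ae (Filter.Eventually.of_forall fun p => ?_)
        have : (fun ω => I ξ p.1 ω * I η p.2 ω) =
            ({ω | p.1 < ξ ω} ∩ {ω | p.2 < η ω}).indicator 1 := by
          ext ω
          by_cases h1 : p.1 < ξ ω <;> by_cases h2 : p.2 < η ω <;>
            simp [hI, h1, h2]
        simp only [this]
        rw [integral_indicator_one ((hset ξ hξ _).inter (hset η hη _))]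
  have hm1 : Measurable fun p : ℝ × ℝ => P.real ({ω | p.1 < ξ ω} ∩ {ω | p.2 < η ω}) := by
    refine Measurable.ennreal_toReal (measurable_measure_prodMk_left
      (s := {q : (ℝ × ℝ) × Ω | q.1.1 < ξ q.2 ∧ q.1.2 < η q.2}) ?_)
    exact (measurableSet_lt (measurable_fst.comp measurable_fst) (hξ.comp measurable_snd)).inter
      (measurableSet_lt (measurable_snd.comp measurable_fst) (hη.comp measurable_snd))
  have hm2 : ∀ ζ : Ω → ℝ, Measurable ζ → Measurable fun u : ℝ => P.real {ω | u < ζ ω} := by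
    intro ζ hζ
    refine Measurable.ennreal_toReal (measurable_measure_prodMk_left
      (s := {q : ℝ × Ω | q.1 < ζ q.2}) ?_)
    exact measurableSet_lt measurable_fst (hζ.comp measurable_snd)
  rw [hEE, hE ξ hξ hξ0 hξM, hE η hη hη0 hηM,
    ← integral_prod_mul (fun u => P.real {ω | u < ξ ω}) (fun u => P.real {ω | u < η ω}),
    ← integral_sub, ← Real.norm_eq_abs]
  · refine (norm_integral_le_of_norm_le_const (C := a)
      (Filter.Eventually.of_forall fun p => ha p.1 p.2)).trans ?_
    have : (ν.prod ν).real Set.univ = M ^ 2 := by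
      rw [measureReal_def, ← Set.univ_prod_univ, Measure.prod_prod, ENNReal.toReal_mul]
      simp [hν, hM, sq]
    rw [this]
  · refine Integrable.of_bound hm1.aestronglyMeasurable 1
      (Filter.Eventually.of_forall fun p => ?_)
    rw [Real.norm_of_nonneg measureReal_nonneg]
    exact measureReal_le_one
  · refine Integrable.of_bound (((hm2 ξ hξ).comp measurable_fst).mul
      ((hm2 η hη).comp measurable_snd)).aestronglyMeasurable 1
      (Filter.Eventually.of_forall fun p => ?_)
    rw [Real.norm_of_nonneg (mul_nonneg measureReal_nonneg measureReal_nonneg)]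
    exact mul_le_one₀ measureReal_le_one measureReal_nonneg measureReal_le_one

theorem abs_integral_mul_sub_le_of_abs_le {ξ η : Ω → ℝ} (hξ : Measurable ξ) (hη : Measurable η)
    {T a : ℝ} (hξT : ∀ ω, |ξ ω| ≤ T) (hηT : ∀ ω, |η ω| ≤ T)
    (ha : ∀ u v : ℝ, |P.real ({ω | u < ξ ω} ∩ {ω | v < η ω}) -
      P.real {ω | u < ξ ω} * P.real {ω | v < η ω}| ≤ a) :
    |∫ ω, ξ ω * η ω ∂P - (∫ ω, ξ ω ∂P) * ∫ ω, η ω ∂P| ≤ 4 * a * T ^ 2 := by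
  have hξi : Integrable ξ P := Integrable.of_bound hξ.aestronglyMeasurable T
    (Filter.Eventually.of_forall hξT)
  have hηi : Integrable η P := Integrable.of_bound hη.aestronglyMeasurable T
    (Filter.Eventually.of_forall hηT)
  have hξη : Integrable (fun ω => ξ ω * η ω) P := by
    refine Integrable.of_bound (hξ.mul hη).aestronglyMeasurable (T * T)
      (Filter.Eventually.of_forall fun ω => ?_)
    rw [norm_mul]
    exact mul_le_mul (hξT ω) (hηT ω) (norm_nonneg _) ((abs_nonneg _).trans (hξT ω))
  -- Shifting by `T` moves the range into `[0, 2T]` and leaves the covariance unchanged; the factor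
  -- `4` is `(2T)² / T²`.
  have h := abs_integral_mul_sub_le_of_mem_Icc (P := P) (ξ := fun ω => ξ ω + T)
    (η := fun ω => η ω + T) (M := 2 * T) (a := a) (hξ.add_const T) (hη.add_const T)
    (fun ω => by linarith [neg_le_of_abs_le (hξT ω)]) (fun ω => by linarith [le_of_abs_le (hξT ω)])
    (fun ω => by linarith [neg_le_of_abs_le (hηT ω)]) (fun ω => by linarith [le_of_abs_le (hηT ω)])
    (fun u v => by
      have := ha (u - T) (v - T)
      simpa only [sub_lt_iff_lt_add] using this)
  have e : ∫ ω, (ξ ω + T) * (η ω + T) ∂P =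
      ∫ ω, ξ ω * η ω ∂P + T * ∫ ω, ξ ω ∂P + T * ∫ ω, η ω ∂P + T * T := by
    have e1 : ∀ ω, (ξ ω + T) * (η ω + T) = ξ ω * η ω + T * ξ ω + T * η ω + T * T := fun ω => by ring
    simp_rw [e1]
    have i1 : Integrable (fun ω => ξ ω * η ω + T * ξ ω) P := hξη.add (hξi.const_mul T)
    have i2 : Integrable (fun ω => ξ ω * η ω + T * ξ ω + T * η ω) P := i1.add (hηi.const_mul T)
    rw [integral_add i2 (integrable_const _), integral_add i1 (hηi.const_mul T),
      integral_add hξη (hξi.const_mul T), integral_const_mul, integral_const_mul]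
    simp
  rw [e, integral_add hξi (integrable_const _), integral_add hηi (integrable_const _)] at h
  simp only [integral_const, probReal_univ, smul_eq_mul, one_mul] at h
  calc _ = _ := by congr 1; ring
    _ ≤ _ := h
    _ = _ := by ring

/-! ### Truncation and covariances of unbounded variables -/

theorem abs_clamp_le {x T : ℝ} (hT : 0 ≤ T) : |max (-T) (min T x)| ≤ T := by
  rw [abs_le]
  exact ⟨le_max_left _ _, max_le (by linarith) (min_le_left _ _)⟩

/-- Clamping multiplies by a factor in `[0, 1]` that equals `1` on `[-T, T]`. So the difference
vanishes unless `m = max |x| |y|` exceeds `T`, and then it is at most `|x y| ≤ m² ≤ m⁴ / T²`. -/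
theorem abs_mul_sub_clamp_mul_clamp_le {T : ℝ} (hT : 0 < T) (x y : ℝ) :
    |x * y - max (-T) (min T x) * max (-T) (min T y)| ≤ (x ^ 4 + y ^ 4) / T ^ 2 := by
  have key : ∀ x : ℝ, ∃ s, 0 ≤ s ∧ s ≤ 1 ∧ max (-T) (min T x) = s * x ∧ (|x| ≤ T → s = 1) := by
    intro x
    by_cases hx : |x| ≤ T
    · obtain ⟨h1, h2⟩ := abs_le.1 hx
      exact ⟨1, zero_le_one, le_rfl, by rw [min_eq_right h2, max_eq_right h1, one_mul],
        fun _ => rfl⟩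
    · push Not at hx
      have hx0 : 0 < |x| := hT.trans hx
      refine ⟨T / |x|, by positivity, (div_le_one hx0).2 hx.le, ?_, fun h => absurd h (not_le.2 hx)⟩
      rcases le_total 0 x with h | h
      · rw [abs_of_nonneg h] at hx hx0 ⊢
        rw [min_eq_left hx.le, max_eq_right (by linarith)]
        field_simp
      · rw [abs_of_nonpos h] at hx hx0 ⊢
        rw [min_eq_right (by linarith), max_eq_left (by linarith)]
        have : x ≠ 0 := by linarith
        field_simp
  obtain ⟨s, s0, s1, hs, hs'⟩ := key x
  obtain ⟨t, t0, t1, ht, ht'⟩ := key y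
  rw [hs, ht]
  by_cases hxy : |x| ≤ T ∧ |y| ≤ T
  · rw [hs' hxy.1, ht' hxy.2]
    simp only [one_mul, sub_self, abs_zero]
    positivity
  · have h1 : |x * y - s * x * (t * y)| ≤ |x| * |y| := by
      have : x * y - s * x * (t * y) = (1 - s * t) * (x * y) := by ring
      rw [this, abs_mul, abs_mul]
      refine mul_le_of_le_one_left (by positivity) ?_
      rw [abs_le]
      constructor <;> nlinarith [mul_nonneg s0 t0, mul_le_one₀ s1 t0 t1]
    refine h1.trans ?_
    rw [le_div_iff₀ (by positivity)]
    have hx4 : x ^ 4 = (|x| ^ 2) ^ 2 := by rw [sq_abs]; ring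
    have hy4 : y ^ 4 = (|y| ^ 2) ^ 2 := by rw [sq_abs]; ring
    rw [hx4, hy4]
    have hT2 : T ^ 2 ≤ |x| ^ 2 + |y| ^ 2 ∧ T ^ 2 ≤ max (|x| ^ 2) (|y| ^ 2) := by
      have : T < |x| ∨ T < |y| := by
        by_contra h
        push Not at h
        exact hxy h
      rcases this with h | h
      · have : T ^ 2 ≤ |x| ^ 2 := by gcongr
        exact ⟨by nlinarith [sq_nonneg |y|], this.trans (le_max_left _ _)⟩
      · have : T ^ 2 ≤ |y| ^ 2 := by gcongr
        exact ⟨by nlinarith [sq_nonneg |x|], this.trans (le_max_right _ _)⟩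
    have hm : |x| * |y| ≤ max (|x| ^ 2) (|y| ^ 2) := by
      rcases le_total |x| |y| with h | h
      · exact le_max_of_le_right (by nlinarith [abs_nonneg y])
      · exact le_max_of_le_left (by nlinarith [abs_nonneg x])
    calc |x| * |y| * T ^ 2 ≤ max (|x| ^ 2) (|y| ^ 2) * max (|x| ^ 2) (|y| ^ 2) :=
          mul_le_mul hm hT2.2 (by positivity) (by positivity)
      _ ≤ _ := by
        rcases max_cases (|x| ^ 2) (|y| ^ 2) with ⟨h, -⟩ | ⟨h, -⟩ <;> rw [h] <;>
          nlinarith [sq_nonneg (|x| ^ 2), sq_nonneg (|y| ^ 2)]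

theorem abs_covariance_le_truncation {ξ η : Ω → ℝ} (hξ : Measurable ξ) (hη : Measurable η)
    (hξ4 : MemLp ξ 4 P) (hη4 : MemLp η 4 P) {T a : ℝ} (hT : 0 < T)
    (ha : ∀ s t : Set ℝ, MeasurableSet s → MeasurableSet t →
      |P.real (ξ ⁻¹' s ∩ η ⁻¹' t) - P.real (ξ ⁻¹' s) * P.real (η ⁻¹' t)| ≤ a) :
    |cov[ξ, η; P]| ≤
      4 * a * T ^ 2 + 2 * ((∫ ω, ξ ω ^ 4 ∂P + ∫ ω, η ω ^ 4 ∂P) / T ^ 2) := by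
  have hξ2 : MemLp ξ 2 P := hξ4.mono_exponent (by norm_num)
  have hη2 : MemLp η 2 P := hη4.mono_exponent (by norm_num)
  have hξi : Integrable ξ P := hξ2.integrable (by norm_num)
  have hηi : Integrable η P := hη2.integrable (by norm_num)
  have hξ4i := integrable_pow_four hξ4
  have hη4i := integrable_pow_four hη4
  set c : ℝ → ℝ := fun x => max (-T) (min T x) with hc
  have hcm : Measurable c := by fun_prop
  have hcb : ∀ x, ‖c x‖ ≤ T := fun x => abs_clamp_le hT.le
  have hci : ∀ ζ : Ω → ℝ, Measurable ζ → Integrable (fun ω => c (ζ ω)) P := fun ζ hζ =>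
    Integrable.of_bound (hcm.comp hζ).aestronglyMeasurable T
      (Filter.Eventually.of_forall fun ω => hcb _)
  have hcci : Integrable (fun ω => c (ξ ω) * c (η ω)) P := by
    refine Integrable.of_bound ((hcm.comp hξ).mul (hcm.comp hη)).aestronglyMeasurable (T * T)
      (Filter.Eventually.of_forall fun ω => ?_)
    rw [norm_mul]
    exact mul_le_mul (hcb _) (hcb _) (norm_nonneg _) hT.le
  have hξη : Integrable (fun ω => ξ ω * η ω) P := hξ2.integrable_mul hη2
  have h1 : |∫ ω, ξ ω * η ω ∂P - ∫ ω, c (ξ ω) * c (η ω) ∂P| ≤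
      (∫ ω, ξ ω ^ 4 ∂P + ∫ ω, η ω ^ 4 ∂P) / T ^ 2 := by
    rw [← integral_sub hξη hcci, ← integral_add hξ4i hη4i,
      ← integral_div, ← Real.norm_eq_abs]
    exact norm_integral_le_of_norm_le ((hξ4i.add hη4i).div_const _)
      (Filter.Eventually.of_forall fun ω => abs_mul_sub_clamp_mul_clamp_le hT _ _)
  -- A product of expectations is an expectation over `P.prod P`, so the same pointwise truncation
  -- bound applies to it.
  have h2 : |(∫ ω, ξ ω ∂P) * (∫ ω, η ω ∂P) - (∫ ω, c (ξ ω) ∂P) * ∫ ω, c (η ω) ∂P| ≤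
      (∫ ω, ξ ω ^ 4 ∂P + ∫ ω, η ω ^ 4 ∂P) / T ^ 2 := by
    have e4 : ∫ ω, ξ ω ^ 4 ∂P + ∫ ω, η ω ^ 4 ∂P =
        ∫ p : Ω × Ω, (ξ p.1 ^ 4 + η p.2 ^ 4) ∂(P.prod P) := by
      rw [integral_add (hξ4i.comp_fst P) (hη4i.comp_snd P),
        integral_fun_fst (fun ω => ξ ω ^ 4), integral_fun_snd (fun ω => η ω ^ 4)]
      simp
    rw [← integral_prod_mul ξ η, ← integral_prod_mul (fun ω => c (ξ ω)) (fun ω => c (η ω)),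
      ← integral_sub (hξi.mul_prod hηi) ((hci ξ hξ).mul_prod (hci η hη)), e4,
      ← integral_div, ← Real.norm_eq_abs]
    exact norm_integral_le_of_norm_le
      (((hξ4i.comp_fst P).add (hη4i.comp_snd P)).div_const _)
      (Filter.Eventually.of_forall fun ω => abs_mul_sub_clamp_mul_clamp_le hT _ _)
  have h3 := abs_integral_mul_sub_le_of_abs_le (P := P) (hcm.comp hξ) (hcm.comp hη) (T := T)
    (a := a) (fun ω => hcb _) (fun ω => hcb _)
    (fun u v => ha (c ⁻¹' Set.Ioi u) (c ⁻¹' Set.Ioi v) (hcm measurableSet_Ioi)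
      (hcm measurableSet_Ioi))
  simp only [Function.comp_apply] at h3
  rw [covariance_eq_sub hξ2 hη2]
  simp only [Pi.mul_apply]
  rw [abs_le] at *
  constructor <;> linarith [h1.1, h1.2, h2.1, h2.2, h3.1, h3.2]

theorem abs_covariance_le_sqrt {ξ η : Ω → ℝ} (hξ : Measurable ξ) (hη : Measurable η)
    (hξ4 : MemLp ξ 4 P) (hη4 : MemLp η 4 P) {a : ℝ} (ha0 : 0 < a)
    (ha : ∀ s t : Set ℝ, MeasurableSet s → MeasurableSet t →
      |P.real (ξ ⁻¹' s ∩ η ⁻¹' t) - P.real (ξ ⁻¹' s) * P.real (η ⁻¹' t)| ≤ a) :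
    |cov[ξ, η; P]| ≤ 6 * (√a * √(∫ ω, ξ ω ^ 4 ∂P + ∫ ω, η ω ^ 4 ∂P)) := by
  set m := ∫ ω, ξ ω ^ 4 ∂P + ∫ ω, η ω ^ 4 ∂P with hm
  have hm0 : 0 ≤ m := add_nonneg (integral_nonneg fun ω => by positivity)
    (integral_nonneg fun ω => by positivity)
  -- The choice `T² = √M / √a` balances the two error terms into `4 √a √M + 2 √a √M`. Working with
  -- `M > m` keeps `T` positive even if `m = 0`; afterwards `M` decreases to `m`.
  have key : ∀ M, m < M → |cov[ξ, η; P]| ≤ 6 * (√a * √M) := by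
    intro M hM
    have hM0 : 0 < M := hm0.trans_lt hM
    have sa := Real.sqrt_pos.2 ha0
    have sM := Real.sqrt_pos.2 hM0
    have ea := Real.sq_sqrt ha0.le
    have eM := Real.sq_sqrt hM0.le
    have h := abs_covariance_le_truncation hξ hη hξ4 hη4 (T := √(√M / √a)) (a := a)
      (Real.sqrt_pos.2 (by positivity)) ha
    rw [Real.sq_sqrt (by positivity), ← hm] at h
    have h1 : 4 * a * (√M / √a) = 4 * (√a * √M) := by
      have : a * (√M / √a) = √a * √M := by
        rw [mul_div_assoc', div_eq_iff sa.ne']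
        linear_combination (-√M) * ea
      linarith
    have h2 : m / (√M / √a) ≤ √a * √M := by
      rw [div_le_iff₀ (by positivity)]
      have : √a * √M * (√M / √a) = M := by
        rw [mul_div_assoc', div_eq_iff sa.ne']
        linear_combination √a * eM
      linarith
    linarith
  refine ge_of_tendsto (x := nhdsWithin m (Set.Ioi m)) (f := fun M => 6 * (√a * √M)) ?_ ?_
  · exact ((continuous_const.mul (continuous_const.mul Real.continuous_sqrt)).tendsto m).mono_left
      nhdsWithin_le_nhds
  · exact Filter.eventually_of_mem self_mem_nhdsWithin key

end CovarianceInequality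

/-! ### Mixing coefficients of pairs of points -/

theorem IsStationaryField.map_pair {Ω : Type*} [MeasurableSpace Ω] {P : Measure Ω} {d : ℕ}
    {X : EuclideanSpace ℝ (Fin d) → Ω → ℝ}
    (hstat : IsStationaryField P X) (hX : ∀ t, Measurable (X t))
    (s t h : EuclideanSpace ℝ (Fin d)) :
    IdentDistrib (fun ω => (X (s + h) ω, X (t + h) ω)) (fun ω => (X s ω, X t ω)) P P := by
  have h2 := hstat 2 ![s, t] h
  have hm : Measurable fun v : Fin 2 → ℝ => (v 0, v 1) := by fun_prop
  have h3 := congrArg (Measure.map fun v : Fin 2 → ℝ => (v 0, v 1)) h2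
  rw [Measure.map_map hm (measurable_pi_lambda _ fun i => hX _),
    Measure.map_map hm (measurable_pi_lambda _ fun i => hX _)] at h3
  exact ⟨((hX _).prodMk (hX _)).aemeasurable, ((hX _).prodMk (hX _)).aemeasurable, h3⟩

theorem IsStationaryField.identDistrib {Ω : Type*} [MeasurableSpace Ω] {P : Measure Ω} {d : ℕ}
    {X : EuclideanSpace ℝ (Fin d) → Ω → ℝ}
    (hstat : IsStationaryField P X) (hX : ∀ t, Measurable (X t))
    (t : EuclideanSpace ℝ (Fin d)) : IdentDistrib (X t) (X 0) P P := by
  have h := (hstat.map_pair hX 0 0 t).comp measurable_fst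
  simpa [Function.comp_def] using h

section Mixing

variable {Ω : Type*} [MeasurableSpace Ω] {P : Measure Ω} [IsProbabilityMeasure P] {d : ℕ}

theorem abs_measureReal_inter_sub_le_one (F G : Set Ω) :
    |P.real (F ∩ G) - P.real F * P.real G| ≤ 1 := by
  have h1 : P.real (F ∩ G) ≤ 1 := measureReal_le_one
  have h2 : P.real F * P.real G ≤ 1 :=
    mul_le_one₀ measureReal_le_one measureReal_nonneg measureReal_le_one
  have h3 : 0 ≤ P.real (F ∩ G) := measureReal_nonneg
  have h4 : 0 ≤ P.real F * P.real G := mul_nonneg measureReal_nonneg measureReal_nonneg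
  rw [abs_le]
  constructor <;> linarith

theorem abs_measureReal_inter_sub_le_alphaCoeff {Ω : Type*} {𝓕 𝓖 : MeasurableSpace Ω}
    [MeasurableSpace Ω] {P : Measure Ω} [IsProbabilityMeasure P] {F G : Set Ω}
    (hF : MeasurableSet[𝓕] F) (hG : MeasurableSet[𝓖] G) :
    |P.real (F ∩ G) - P.real F * P.real G| ≤ alphaCoeff P 𝓕 𝓖 := by
  refine le_csSup ⟨1, ?_⟩ ⟨F, G, hF, hG, rfl⟩
  rintro a ⟨F, G, -, -, rfl⟩
  exact abs_measureReal_inter_sub_le_one F G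

theorem alphaCoeff_le_one {Ω : Type*} (𝓕 𝓖 : MeasurableSpace Ω) [MeasurableSpace Ω]
    {P : Measure Ω} [IsProbabilityMeasure P] : alphaCoeff P 𝓕 𝓖 ≤ 1 := by
  refine csSup_le ⟨_, ∅, ∅, @MeasurableSet.empty _ 𝓕, @MeasurableSet.empty _ 𝓖, rfl⟩ ?_
  rintro a ⟨F, G, -, -, rfl⟩
  exact abs_measureReal_inter_sub_le_one F G

theorem alphaCoeff_le_alphaMixing {X : EuclideanSpace ℝ (Fin d) → Ω → ℝ}
    {I J : Set (EuclideanSpace ℝ (Fin d))} {γ r : ℝ} (hIJ : StripSeparated I J r)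
    (hγ : volume ((I ∪ J) + unitBall d) ≤ ENNReal.ofReal γ) :
    alphaCoeff P (sigmaField X I) (sigmaField X J) ≤ alphaMixing P X γ r := by
  refine le_csSup ⟨1, ?_⟩ ⟨I, J, hIJ, hγ, rfl⟩
  rintro a ⟨I, J, -, -, rfl⟩
  exact alphaCoeff_le_one _ _

theorem stripSeparated_singleton {t : EuclideanSpace ℝ (Fin d)} {r : ℝ} (hr : 0 < r)
    (ht : r < ‖t‖) : StripSeparated {t} {0} r := by
  have h0 : ‖t‖ ≠ 0 := by linarith
  refine ⟨‖t‖⁻¹ • t, by rw [norm_smul, norm_inv, norm_norm, inv_mul_cancel₀ h0], ‖t‖, 0, ?_, ?_,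
    by simpa using ht⟩
  · have : inner ℝ (‖t‖⁻¹ • t) t = ‖t‖ := by
      rw [real_inner_smul_left, real_inner_self_eq_norm_sq]
      field_simp
    rw [Set.image_singleton, this]
    exact isLeast_singleton
  · rw [Set.image_singleton, inner_zero_right]
    exact isGreatest_singleton

theorem volume_pair_add_unitBall_le (t : EuclideanSpace ℝ (Fin d)) :
    volume (({t} ∪ {0} : Set (EuclideanSpace ℝ (Fin d))) + unitBall d) ≤
      ENNReal.ofReal (2 * kappa d) := by
  have hfin : volume (unitBall d) ≠ ⊤ := measure_closedBall_lt_top.ne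
  have h1 : ∀ s : EuclideanSpace ℝ (Fin d), volume ({s} + unitBall d) = volume (unitBall d) := by
    intro s
    rw [Set.singleton_add, ← measure_preimage_add volume (-s) (unitBall d)]
    congr 1
    ext x
    simp
  rw [Set.union_add, ENNReal.ofReal_mul zero_le_two, kappa, ofReal_measureReal hfin]
  refine (measure_union_le _ _).trans ?_
  rw [h1, h1, ← two_mul]
  simp

theorem measurableSet_sigmaField_singleton {Ω : Type*} {d : ℕ}
    {X : EuclideanSpace ℝ (Fin d) → Ω → ℝ}
    (t : EuclideanSpace ℝ (Fin d)) {s : Set ℝ} (hs : MeasurableSet s) :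
    MeasurableSet[sigmaField X {t}] (X t ⁻¹' s) := by
  have h : MeasurableSpace.comap (X t) (borel ℝ) ≤ sigmaField X {t} :=
    le_iSup₂_of_le t (Set.mem_singleton t) le_rfl
  refine h _ ⟨s, ?_, rfl⟩
  rwa [← BorelSpace.measurable_eq (α := ℝ)]

/-- Two points fit the mixing condition with the smallest volume `γ = 2 κ_d`, which turns the rate
into plain polynomial decay in the lag. The constant is kept strictly positive because
`abs_covariance_le_sqrt` divides by `√a`. -/
theorem exists_pair_mixing_bound {X : EuclideanSpace ℝ (Fin d) → Ω → ℝ} {n : ℕ} {C l : ℝ}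
    (hmix : ∀ γ r : ℝ, 2 * kappa d ≤ γ → 0 < r →
      alphaMixing P X γ r ≤ C * r ^ (-(n : ℤ)) * γ ^ l) :
    ∃ A : ℝ, 0 < A ∧ ∀ (t : EuclideanSpace ℝ (Fin d)) (s s' : Set ℝ),
      MeasurableSet s → MeasurableSet s' →
      |P.real (X 0 ⁻¹' s ∩ X t ⁻¹' s') - P.real (X 0 ⁻¹' s) * P.real (X t ⁻¹' s')| ≤
        A * (1 + ‖t‖) ^ (-(n : ℝ)) := by
  set D : ℝ := |C * (2 * kappa d) ^ l| with hD
  -- The summand `2 ^ n` covers `‖t‖ ≤ 1`, where the dependence is trivially at most `1`; the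
  -- summand `4 ^ n * D` covers `‖t‖ > 1`, where `(2 / ‖t‖) (1 + ‖t‖) ≤ 4`.
  refine ⟨4 ^ n * D + 2 ^ n, by positivity, fun t s s' hs hs' => ?_⟩
  have ht0 : 0 ≤ ‖t‖ := norm_nonneg t
  have hp : (0 : ℝ) < (1 + ‖t‖) ^ n := by positivity
  rw [Real.rpow_neg (by positivity), Real.rpow_natCast, ← div_eq_mul_inv, le_div_iff₀ hp]
  rcases le_or_gt ‖t‖ 1 with ht | ht
  · have h1 := abs_measureReal_inter_sub_le_one (P := P) (X 0 ⁻¹' s) (X t ⁻¹' s')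
    have h2 : (1 + ‖t‖) ^ n ≤ 2 ^ n := by
      gcongr
      linarith
    have h3 : 0 ≤ 4 ^ n * D := by positivity
    nlinarith [mul_le_mul h1 h2 hp.le zero_le_one]
  -- The strip width must be strictly less than `‖t‖`, hence the radius `‖t‖ / 2`.
  · have hr : 0 < ‖t‖ / 2 := by linarith
    have h1 : |P.real (X 0 ⁻¹' s ∩ X t ⁻¹' s') - P.real (X 0 ⁻¹' s) * P.real (X t ⁻¹' s')| ≤
        alphaCoeff P (sigmaField X {t}) (sigmaField X {0}) := by
      rw [Set.inter_comm, mul_comm]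
      exact abs_measureReal_inter_sub_le_alphaCoeff (measurableSet_sigmaField_singleton t hs')
        (measurableSet_sigmaField_singleton 0 hs)
    have h2 := alphaCoeff_le_alphaMixing (P := P) (X := X)
      (stripSeparated_singleton hr (by linarith : ‖t‖ / 2 < ‖t‖)) (volume_pair_add_unitBall_le t)
    have h3 := hmix (2 * kappa d) (‖t‖ / 2) le_rfl hr
    have h4 : C * (‖t‖ / 2) ^ (-(n : ℤ)) * (2 * kappa d) ^ l ≤ D * (2 / ‖t‖) ^ n := by
      rw [zpow_neg, zpow_natCast, ← inv_pow, inv_div, mul_right_comm]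
      exact mul_le_mul_of_nonneg_right (le_abs_self _) (by positivity)
    have h5 : (2 / ‖t‖) ^ n * (1 + ‖t‖) ^ n ≤ 4 ^ n := by
      rw [← mul_pow]
      gcongr
      rw [div_mul_eq_mul_div, div_le_iff₀ (by linarith)]
      linarith
    calc _ ≤ D * (2 / ‖t‖) ^ n * (1 + ‖t‖) ^ n := by
          gcongr
          linarith
      _ ≤ 4 ^ n * D := by
        rw [mul_assoc, mul_comm]
        exact mul_le_mul_of_nonneg_right h5 (abs_nonneg _)
      _ ≤ _ := by linarith [pow_pos (two_pos (α := ℝ)) n]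

/-- The square root in the covariance inequality halves the decay exponent, and `(1 + ‖t‖) ^ (-n/2)`
is integrable on `ℝ^d` exactly when `n/2 > d`. -/
theorem IsStationaryField.exists_integrable_covariance_bound
    {X : EuclideanSpace ℝ (Fin d) → Ω → ℝ}
    (hstat : IsStationaryField P X) (hX : ∀ t, Measurable (X t)) {n : ℕ} {C l : ℝ}
    (hn : 2 * (d : ℝ) < n)
    (hmix : ∀ γ r : ℝ, 2 * kappa d ≤ γ → 0 < r →
      alphaMixing P X γ r ≤ C * r ^ (-(n : ℤ)) * γ ^ l) :
    ∃ ρ : EuclideanSpace ℝ (Fin d) → ℝ, Integrable ρ ∧ (∀ t, 0 ≤ ρ t) ∧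
      ∀ f g : ℝ → ℝ, Measurable f → Measurable g → MemLp (fun ω => f (X 0 ω)) 4 P →
        MemLp (fun ω => g (X 0 ω)) 4 P → ∀ t,
        |cov[fun ω => f (X 0 ω), fun ω => g (X t ω); P]| ≤
          ρ t * √(∫ ω, f (X 0 ω) ^ 4 ∂P + ∫ ω, g (X 0 ω) ^ 4 ∂P) := by
  obtain ⟨A, hA, hbound⟩ := exists_pair_mixing_bound hmix
  refine ⟨fun t => 6 * √A * (1 + ‖t‖) ^ (-((n : ℝ) / 2)), ?_, fun t => by positivity, ?_⟩
  · refine (integrable_one_add_norm ?_).const_mul _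
    rw [finrank_euclideanSpace_fin]
    linarith
  · intro f g hf hg hf4 hg4 t
    have hid : IdentDistrib (fun ω => g (X t ω)) (fun ω => g (X 0 ω)) P P :=
      (hstat.identDistrib hX t).comp hg
    have hid4 : ∫ ω, g (X t ω) ^ 4 ∂P = ∫ ω, g (X 0 ω) ^ 4 ∂P :=
      (hid.comp (measurable_id.pow_const 4)).integral_eq
    have h := abs_covariance_le_sqrt (P := P) (hf.comp (hX 0)) (hg.comp (hX t)) hf4
      (hid.memLp_iff.2 hg4) (a := A * (1 + ‖t‖) ^ (-(n : ℝ))) (by positivity)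
      (fun s s' hs hs' => hbound t (f ⁻¹' s) (g ⁻¹' s') (hf hs) (hg hs'))
    simp only [Function.comp_apply] at h
    rw [hid4] at h
    have e : √(A * (1 + ‖t‖) ^ (-(n : ℝ))) = √A * (1 + ‖t‖) ^ (-((n : ℝ) / 2)) := by
      rw [Real.sqrt_mul hA.le, Real.sqrt_eq_rpow ((1 + ‖t‖) ^ (-(n : ℝ))),
        ← Real.rpow_mul (by positivity)]
      congr 2
      ring
    rw [e] at h
    calc _ ≤ _ := h
      _ = _ := by ring

end Mixing

/-! ### The integrated covariance as a positive semidefinite bilinear form -/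

theorem LipSpace.abs_apply_le (f : LipSpace) (x : ℝ) : |f x| ≤ ‖f‖ * (1 + |x|) := by
  have h := f.abs_sub_le_lip x 0
  rw [sub_zero] at h
  have h1 : |f x| ≤ |f x - f 0| + |f 0| := by simpa using abs_add_le (f x - f 0) (f 0)
  rw [LipSpace.norm_def]
  nlinarith [abs_nonneg (f 0), abs_nonneg x, f.lip_nonneg]

theorem LipSpace.continuous (f : LipSpace) : Continuous (f : ℝ → ℝ) := by
  obtain ⟨K, hK⟩ := f.2
  exact hK.continuous

theorem LipSpace.measurable (f : LipSpace) : Measurable (f : ℝ → ℝ) := f.continuous.measurable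

/-- A jointly measurable stationary field with fourth moments, whose covariances are dominated by
an integrable function of the lag. -/
structure HasIntegrableCovarianceBound {Ω : Type*} [MeasurableSpace Ω] {d : ℕ} (P : Measure Ω)
    (X : EuclideanSpace ℝ (Fin d) → Ω → ℝ) (ρ : EuclideanSpace ℝ (Fin d) → ℝ) : Prop where
  measurable : Measurable (fun p : EuclideanSpace ℝ (Fin d) × Ω => X p.1 p.2)
  stationary : IsStationaryField P X
  memLp : MemLp (X 0) 4 P
  integrable : Integrable ρ
  nonneg : ∀ t, 0 ≤ ρ t
  bound : ∀ f g : ℝ → ℝ, Measurable f → Measurable g → MemLp (fun ω => f (X 0 ω)) 4 P →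
    MemLp (fun ω => g (X 0 ω)) 4 P → ∀ t,
      |cov[fun ω => f (X 0 ω), fun ω => g (X t ω); P]| ≤
        ρ t * √(∫ ω, f (X 0 ω) ^ 4 ∂P + ∫ ω, g (X 0 ω) ^ 4 ∂P)

namespace HasIntegrableCovarianceBound

variable {Ω : Type*} [MeasurableSpace Ω] {d : ℕ} {P : Measure Ω} [IsProbabilityMeasure P]
  {X : EuclideanSpace ℝ (Fin d) → Ω → ℝ} {ρ : EuclideanSpace ℝ (Fin d) → ℝ}

omit [IsProbabilityMeasure P] in
theorem measurable_apply (H : HasIntegrableCovarianceBound P X ρ) (t : EuclideanSpace ℝ (Fin d)) :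
    Measurable (X t) := H.measurable.comp measurable_prodMk_left

theorem memLp_comp (H : HasIntegrableCovarianceBound P X ρ) (f : LipSpace)
    (t : EuclideanSpace ℝ (Fin d)) : MemLp (fun ω => f (X t ω)) 4 P := by
  have h0 : MemLp (fun ω => f (X 0 ω)) 4 P := by
    have h1 : MemLp (fun ω => 1 + |X 0 ω|) 4 P := (memLp_const (1 : ℝ)).add H.memLp.norm
    have h2 : AEStronglyMeasurable (fun ω => f (X 0 ω)) P :=
      (f.measurable.comp (H.measurable_apply 0)).aestronglyMeasurable
    refine h1.of_le_mul (c := ‖f‖) h2 (Filter.Eventually.of_forall fun ω => ?_)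
    rw [Real.norm_eq_abs, Real.norm_of_nonneg (by positivity)]
    exact f.abs_apply_le _
  exact ((H.stationary.identDistrib H.measurable_apply t).comp f.measurable).memLp_iff.2 h0

theorem memLp_two_comp (H : HasIntegrableCovarianceBound P X ρ) (f : LipSpace)
    (t : EuclideanSpace ℝ (Fin d)) : MemLp (fun ω => f (X t ω)) 2 P :=
  (H.memLp_comp f t).mono_exponent (by norm_num)

theorem integrable_covariance (H : HasIntegrableCovarianceBound P X ρ) (f g : LipSpace) :
    Integrable (fun t => cov[fun ω => f (X 0 ω), fun ω => g (X t ω); P]) := by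
  refine (H.integrable.mul_const (√(∫ ω, f (X 0 ω) ^ 4 ∂P + ∫ ω, g (X 0 ω) ^ 4 ∂P))).mono' ?_
    (Filter.Eventually.of_forall fun t => H.bound f g f.measurable g.measurable
      (H.memLp_comp f 0) (H.memLp_comp g 0) t)
  have h1 : StronglyMeasurable fun t => ∫ ω, f (X 0 ω) * g (X t ω) ∂P := by
    refine StronglyMeasurable.integral_prod_right (f := fun t ω => f (X 0 ω) * g (X t ω))
      (Measurable.stronglyMeasurable ?_)
    exact (f.measurable.comp ((H.measurable_apply 0).comp measurable_snd)).mul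
      (g.measurable.comp H.measurable)
  have h2 : StronglyMeasurable fun t => ∫ ω, g (X t ω) ∂P :=
    StronglyMeasurable.integral_prod_right (f := fun t ω => g (X t ω))
      (g.measurable.comp H.measurable).stronglyMeasurable
  simp_rw [covariance_eq_sub (H.memLp_two_comp f 0) (H.memLp_two_comp g _)]
  exact (h1.sub (stronglyMeasurable_const.mul h2)).aestronglyMeasurable

theorem asymCov_add_left (H : HasIntegrableCovarianceBound P X ρ) (f f' g : LipSpace) :
    asymCov P X (f + f') g = asymCov P X f g + asymCov P X f' g := by
  rw [asymCov, asymCov, asymCov, ← integral_add (H.integrable_covariance f g)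
    (H.integrable_covariance f' g)]
  refine integral_congr_ae (Filter.Eventually.of_forall fun t => ?_)
  exact covariance_add_left (H.memLp_two_comp f 0) (H.memLp_two_comp f' 0) (H.memLp_two_comp g t)

omit [IsProbabilityMeasure P] in
theorem asymCov_smul_left (c : ℝ) (f g : LipSpace) :
    asymCov P X (c • f) g = c * asymCov P X f g := by
  rw [asymCov, asymCov, ← integral_const_mul]
  refine integral_congr_ae (Filter.Eventually.of_forall fun t => ?_)
  exact covariance_smul_left c

/-- Reflect `t ↦ -t` and use that `(X (-t), X 0)` and `(X 0, X t)` have the same law. -/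
theorem asymCov_comm (H : HasIntegrableCovarianceBound P X ρ) (f g : LipSpace) :
    asymCov P X f g = asymCov P X g f := by
  rw [asymCov, asymCov, ← integral_neg_eq_self]
  refine integral_congr_ae (Filter.Eventually.of_forall fun t => ?_)
  simp only
  rw [covariance_comm, covariance_eq_sub (H.memLp_two_comp g _) (H.memLp_two_comp f _),
    covariance_eq_sub (H.memLp_two_comp g _) (H.memLp_two_comp f _)]
  have hg : ∀ s, ∫ ω, g (X s ω) ∂P = ∫ ω, g (X 0 ω) ∂P := fun s =>
    ((H.stationary.identDistrib H.measurable_apply s).comp g.measurable).integral_eq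
  have hf : ∀ s, ∫ ω, f (X s ω) ∂P = ∫ ω, f (X 0 ω) ∂P := fun s =>
    ((H.stationary.identDistrib H.measurable_apply s).comp f.measurable).integral_eq
  have h := ((H.stationary.map_pair H.measurable_apply (-t) 0 t).comp
    (u := fun p : ℝ × ℝ => g p.1 * f p.2)
    ((g.measurable.comp measurable_fst).mul (f.measurable.comp measurable_snd))).integral_eq
  simp only [Function.comp_def, neg_add_cancel, zero_add] at h
  simp only [Pi.mul_apply, hg, hf, h]

/-- The integrated covariance as a bilinear form. -/
def covForm (H : HasIntegrableCovarianceBound P X ρ) : LinearMap.BilinForm ℝ LipSpace :=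
  LinearMap.mk₂ ℝ (asymCov P X) H.asymCov_add_left asymCov_smul_left
    (fun f g g' => by
      rw [H.asymCov_comm, H.asymCov_add_left, H.asymCov_comm g, H.asymCov_comm g'])
    (fun c f g => by
      rw [H.asymCov_comm, asymCov_smul_left, H.asymCov_comm, smul_eq_mul])

theorem covForm_apply (H : HasIntegrableCovarianceBound P X ρ) (f g : LipSpace) :
    H.covForm f g = asymCov P X f g := rfl

/-- Covariances do not see additive constants, so `c` is free. This freedom is essential later:
hinges far to the left are close to `1` rather than `0`, and the expansion recovers a function only
up to a constant. -/
theorem asymCov_self_le (H : HasIntegrableCovarianceBound P X ρ) (f : LipSpace) (c : ℝ) :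
    asymCov P X f f ≤ (∫ t, ρ t) * √(2 * ∫ ω, (f (X 0 ω) - c) ^ 4 ∂P) := by
  have hm : MemLp (fun ω => f (X 0 ω) - c) 4 P := (H.memLp_comp f 0).sub (memLp_const c)
  have hcov : ∀ t, cov[fun ω => f (X 0 ω), fun ω => f (X t ω); P] =
      cov[fun ω => f (X 0 ω) - c, fun ω => f (X t ω) - c; P] := fun t => by
    rw [covariance_sub_const_left ((H.memLp_two_comp f 0).integrable (by norm_num)),
      covariance_sub_const_right ((H.memLp_two_comp f t).integrable (by norm_num))]
  rw [asymCov, ← integral_mul_const]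
  refine integral_mono (H.integrable_covariance f f) (H.integrable.mul_const _) fun t => ?_
  simp only
  rw [hcov, two_mul]
  exact (le_abs_self _).trans (H.bound (fun x => f x - c) (fun x => f x - c)
    (f.measurable.sub_const c) (f.measurable.sub_const c) hm hm t)

/-! ### Positivity of the integrated covariance -/

omit [IsProbabilityMeasure P] in
theorem integral_mul_lag (H : HasIntegrableCovarianceBound P X ρ) (f : LipSpace)
    (s t : EuclideanSpace ℝ (Fin d)) :
    ∫ ω, (f (X s ω) - ∫ ω, f (X 0 ω) ∂P) * (f (X t ω) - ∫ ω, f (X 0 ω) ∂P) ∂P =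
      cov[fun ω => f (X 0 ω), fun ω => f (X (t - s) ω); P] := by
  set m := ∫ ω, f (X 0 ω) ∂P with hm
  have hf : ∀ s, ∫ ω, f (X s ω) ∂P = m := fun s =>
    ((H.stationary.identDistrib H.measurable_apply s).comp f.measurable).integral_eq
  have h := ((H.stationary.map_pair H.measurable_apply 0 (t - s) s).comp
    (u := fun p : ℝ × ℝ => (f p.1 - m) * (f p.2 - m))
    (((f.measurable.comp measurable_fst).sub_const m).mul
      ((f.measurable.comp measurable_snd).sub_const m))).integral_eq
  simp only [Function.comp_def, zero_add, sub_add_cancel] at h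
  simp only [h, covariance, hf]

/-- For Gaussian `φ` and centered `Z`, the number `E (∫ φ(s) Z(s) ds)²` is nonnegative and, by
Fubini, equals `∫ R(u) (∫ φ(s) φ(s + u) ds) du`. The inner integral is a positive multiple of `exp
(-(ε/2) ‖u‖²)`, so it can be divided out. -/
theorem integral_gaussian_weight_nonneg (H : HasIntegrableCovarianceBound P X ρ) (f : LipSpace)
    {ε : ℝ} (hε : 0 < ε) :
    0 ≤ ∫ u, cov[fun ω => f (X 0 ω), fun ω => f (X u ω); P] * Real.exp (-(ε / 2) * ‖u‖ ^ 2) := by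
  set m := ∫ ω, f (X 0 ω) ∂P with hm
  set R : EuclideanSpace ℝ (Fin d) → ℝ :=
    fun u => cov[fun ω => f (X 0 ω), fun ω => f (X u ω); P] with hR
  set φ : EuclideanSpace ℝ (Fin d) → ℝ := fun s => Real.exp (-ε * ‖s‖ ^ 2) with hφ
  set Z : EuclideanSpace ℝ (Fin d) → Ω → ℝ := fun s ω => f (X s ω) - m with hZ
  have hexp : ∀ b : ℝ, 0 < b →
      Integrable (fun s : EuclideanSpace ℝ (Fin d) => Real.exp (-b * ‖s‖ ^ 2)) := by
    intro b hb
    -- A non-integrable function has integral `0` by convention, which contradicts the positive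
    -- value of the Gaussian integral.
    by_contra h
    have := GaussianFourier.integral_rexp_neg_mul_sq_norm (V := EuclideanSpace ℝ (Fin d)) hb
    rw [integral_undef h] at this
    have : (0 : ℝ) < (Real.pi / b) ^ ((Module.finrank ℝ (EuclideanSpace ℝ (Fin d)) : ℝ) / 2) := by
      positivity
    linarith
  have hφi : Integrable φ := hexp ε hε
  have hφ0 : ∀ s, 0 ≤ φ s := fun s => (Real.exp_pos _).le
  have hφ1 : ∀ s, φ s ≤ 1 := fun s => Real.exp_le_one_iff.2 (by nlinarith [sq_nonneg ‖s‖])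
  have hφm : Measurable φ := by fun_prop
  have hRi : Integrable R := H.integrable_covariance f f
  have hZ2 : ∀ s, MemLp (Z s) 2 P := fun s => (H.memLp_two_comp f s).sub (memLp_const m)
  have hZm : Measurable fun p : EuclideanSpace ℝ (Fin d) × Ω => Z p.1 p.2 :=
    (f.measurable.comp H.measurable).sub_const m
  have hZZ : ∀ s t, ∫ ω, Z s ω * Z t ω ∂P = R (t - s) := fun s t => H.integral_mul_lag f s t
  -- The bound `2 |Z s Z t| ≤ Z s ² + Z t ²` and stationarity give domination uniform in `s` and
  -- `t`, which makes the triple integral absolutely convergent.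
  have hbd : ∀ s t, ∫ ω, ‖Z s ω * Z t ω‖ ∂P ≤ R 0 := by
    intro s t
    have h1 : ∀ s, ∫ ω, Z s ω ^ 2 ∂P = R 0 := fun s => by
      rw [← sub_self s, ← hZZ s s]
      simp_rw [sq]
    have h2 : ∫ ω, ‖Z s ω * Z t ω‖ ∂P ≤ ∫ ω, (Z s ω ^ 2 + Z t ω ^ 2) / 2 ∂P := by
      refine integral_mono ((hZ2 s).integrable_mul (hZ2 t)).norm
        (((hZ2 s).integrable_sq.add (hZ2 t).integrable_sq).div_const 2) fun ω => ?_
      simp only [norm_mul, Real.norm_eq_abs]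
      nlinarith [sq_nonneg (|Z s ω| - |Z t ω|), sq_abs (Z s ω), sq_abs (Z t ω)]
    rw [integral_div, integral_add (hZ2 s).integrable_sq (hZ2 t).integrable_sq, h1, h1] at h2
    linarith
  have hF : Integrable (fun q : (EuclideanSpace ℝ (Fin d) × EuclideanSpace ℝ (Fin d)) × Ω =>
      (φ q.1.1 * Z q.1.1 q.2) * (φ q.1.2 * Z q.1.2 q.2)) ((volume.prod volume).prod P) := by
    have hmeasF : Measurable (fun q : (EuclideanSpace ℝ (Fin d) × EuclideanSpace ℝ (Fin d)) × Ω =>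
        (φ q.1.1 * Z q.1.1 q.2) * (φ q.1.2 * Z q.1.2 q.2)) :=
      ((hφm.comp (measurable_fst.comp measurable_fst)).mul
        (hZm.comp ((measurable_fst.comp measurable_fst).prodMk measurable_snd))).mul
      ((hφm.comp (measurable_snd.comp measurable_fst)).mul
        (hZm.comp ((measurable_snd.comp measurable_fst).prodMk measurable_snd)))
    rw [integrable_prod_iff hmeasF.aestronglyMeasurable]
    constructor
    · exact Filter.Eventually.of_forall fun p =>
        ((hZ2 p.1).const_mul (φ p.1)).integrable_mul ((hZ2 p.2).const_mul (φ p.2))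
    · refine ((hφi.mul_prod hφi).mul_const (R 0)).mono'
        hmeasF.norm.stronglyMeasurable.integral_prod_right'.aestronglyMeasurable
        (Filter.Eventually.of_forall fun p => ?_)
      rw [Real.norm_of_nonneg (integral_nonneg fun ω => norm_nonneg _)]
      have : ∀ ω, ‖(φ p.1 * Z p.1 ω) * (φ p.2 * Z p.2 ω)‖ =
          φ p.1 * φ p.2 * ‖Z p.1 ω * Z p.2 ω‖ := fun ω => by
        rw [mul_mul_mul_comm, norm_mul, Real.norm_of_nonneg (mul_nonneg (hφ0 _) (hφ0 _))]
      simp only [this]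
      rw [integral_const_mul]
      exact mul_le_mul_of_nonneg_left (hbd _ _) (mul_nonneg (hφ0 _) (hφ0 _))
  have e1 : ∫ ω, (∫ s, φ s * Z s ω) ^ 2 ∂P =
      ∫ p : EuclideanSpace ℝ (Fin d) × EuclideanSpace ℝ (Fin d),
        φ p.1 * φ p.2 * R (p.2 - p.1) ∂(volume.prod volume) := by
    calc ∫ ω, (∫ s, φ s * Z s ω) ^ 2 ∂P =
          ∫ ω, ∫ p : EuclideanSpace ℝ (Fin d) × EuclideanSpace ℝ (Fin d),
            (φ p.1 * Z p.1 ω) * (φ p.2 * Z p.2 ω) ∂(volume.prod volume) ∂P := by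
          refine integral_congr_ae (Filter.Eventually.of_forall fun ω => ?_)
          simp only
          rw [integral_prod_mul (fun s => φ s * Z s ω) (fun s => φ s * Z s ω), sq]
      _ = ∫ p : EuclideanSpace ℝ (Fin d) × EuclideanSpace ℝ (Fin d), ∫ ω,
            (φ p.1 * Z p.1 ω) * (φ p.2 * Z p.2 ω) ∂P ∂(volume.prod volume) :=
          (integral_integral_swap (f := fun (p : EuclideanSpace ℝ (Fin d) ×
            EuclideanSpace ℝ (Fin d)) ω => (φ p.1 * Z p.1 ω) * (φ p.2 * Z p.2 ω)) hF).symm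
      _ = _ := by
        refine integral_congr_ae (Filter.Eventually.of_forall fun p => ?_)
        simp only
        rw [← hZZ, ← integral_const_mul]
        refine integral_congr_ae (Filter.Eventually.of_forall fun ω => ?_)
        simp only
        ring
  have hG : Integrable (fun p : EuclideanSpace ℝ (Fin d) × EuclideanSpace ℝ (Fin d) =>
      φ p.1 * φ (p.1 + p.2) * R p.2) (volume.prod volume) := by
    refine (hφi.mul_prod hRi.norm).mono' ?_ (Filter.Eventually.of_forall fun p => ?_)
    · exact (((hφm.comp measurable_fst).mul
        (hφm.comp (measurable_fst.add measurable_snd))).aestronglyMeasurable).mul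
        hRi.aestronglyMeasurable.comp_snd
    · rw [norm_mul, norm_mul, Real.norm_of_nonneg (hφ0 _), Real.norm_of_nonneg (hφ0 _)]
      exact mul_le_mul_of_nonneg_right (mul_le_of_le_one_right (hφ0 _) (hφ1 _)) (norm_nonneg _)
  have e2 : ∫ p : EuclideanSpace ℝ (Fin d) × EuclideanSpace ℝ (Fin d),
        φ p.1 * φ p.2 * R (p.2 - p.1) ∂(volume.prod volume) =
      ∫ p : EuclideanSpace ℝ (Fin d) × EuclideanSpace ℝ (Fin d),
        φ p.1 * φ (p.1 + p.2) * R p.2 ∂(volume.prod volume) := by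
    -- The shear `(s, u) ↦ (s, s + u)` preserves volume and turns the second point into the lag.
    rw [← (measurePreserving_prod_add (volume : Measure (EuclideanSpace ℝ (Fin d)))
      volume).integral_comp (MeasurableEquiv.shearAddRight _).measurableEmbedding]
    simp
  have e3 : ∀ u, ∫ s, φ s * φ (s + u) * R u =
      R u * Real.exp (-(ε / 2) * ‖u‖ ^ 2) *
        ∫ s : EuclideanSpace ℝ (Fin d), Real.exp (-(2 * ε) * ‖s‖ ^ 2) := by
    intro u
    -- Completing the square: `‖s‖² + ‖s + u‖² = 2 ‖s + u/2‖² + ‖u‖² / 2`.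
    have hpt : ∀ s, φ s * φ (s + u) = Real.exp (-(ε / 2) * ‖u‖ ^ 2) *
        Real.exp (-(2 * ε) * ‖s + (2 : ℝ)⁻¹ • u‖ ^ 2) := by
      intro s
      simp only [hφ]
      rw [← Real.exp_add, ← Real.exp_add, norm_add_sq_real, norm_add_sq_real, norm_smul,
        real_inner_smul_right]
      congr 1
      norm_num
      ring
    simp_rw [hpt]
    rw [integral_mul_const, integral_const_mul, integral_add_right_eq_self
      (fun s : EuclideanSpace ℝ (Fin d) => Real.exp (-(2 * ε) * ‖s‖ ^ 2))]
    ring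
  have h0 : 0 ≤ ∫ ω, (∫ s, φ s * Z s ω) ^ 2 ∂P := integral_nonneg fun ω => sq_nonneg _
  rw [e1, e2, integral_prod_symm _ hG] at h0
  simp only [e3] at h0
  rw [integral_mul_const] at h0
  have hc : 0 < ∫ s : EuclideanSpace ℝ (Fin d), Real.exp (-(2 * ε) * ‖s‖ ^ 2) := by
    rw [GaussianFourier.integral_rexp_neg_mul_sq_norm (by positivity)]
    positivity
  exact nonneg_of_mul_nonneg_left h0 hc

/-- The Gaussian weights with `ε = 1 / (k + 1)` increase to `1`; dominated convergence with the
integrable covariance as majorant passes to the limit. -/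
theorem asymCov_self_nonneg (H : HasIntegrableCovarianceBound P X ρ) (f : LipSpace) :
    0 ≤ asymCov P X f f := by
  refine ge_of_tendsto' (x := Filter.atTop) (f := fun k : ℕ =>
    ∫ u, cov[fun ω => f (X 0 ω), fun ω => f (X u ω); P] *
      Real.exp (-((1 / ((k : ℝ) + 1)) / 2) * ‖u‖ ^ 2)) ?_
    fun k => H.integral_gaussian_weight_nonneg f (by positivity)
  refine tendsto_integral_of_dominated_convergence
    (fun u => ‖cov[fun ω => f (X 0 ω), fun ω => f (X u ω); P]‖) (fun k => ?_)
    (H.integrable_covariance f f).norm (fun k => Filter.Eventually.of_forall fun u => ?_)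
    (Filter.Eventually.of_forall fun u => ?_)
  · exact (H.integrable_covariance f f).aestronglyMeasurable.mul
      (Measurable.aestronglyMeasurable (by fun_prop))
  · rw [norm_mul, Real.norm_of_nonneg (Real.exp_pos _).le]
    refine mul_le_of_le_one_right (norm_nonneg _) (Real.exp_le_one_iff.2 ?_)
    have : 0 ≤ (1 / ((k : ℝ) + 1)) / 2 * ‖u‖ ^ 2 := by positivity
    linarith
  · have h1 : Filter.Tendsto (fun k : ℕ => -((1 / ((k : ℝ) + 1)) / 2) * ‖u‖ ^ 2) Filter.atTop
        (nhds 0) := by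
      have := ((tendsto_one_div_add_atTop_nhds_zero_nat (𝕜 := ℝ)).div_const 2).neg.mul_const
        (‖u‖ ^ 2)
      simpa using this
    have h2 := (Real.continuous_exp.tendsto 0).comp h1
    rw [Real.exp_zero] at h2
    simpa using h2.const_mul (cov[fun ω => f (X 0 ω), fun ω => f (X u ω); P])

end HasIntegrableCovarianceBound

/-! ### Gaussian processes with a prescribed covariance form -/

section GaussianConstruction

variable {Ω : Type*} [MeasurableSpace Ω] {P : Measure Ω} [IsProbabilityMeasure P]

theorem integral_abs_sub_le_norm_sub (Y Z : Lp ℝ 2 P) :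
    ∫ ω, |Y ω - Z ω| ∂P ≤ ‖Y - Z‖ := by
  have h1 : ∫ ω, |Y ω - Z ω| ∂P = (eLpNorm (⇑(Y - Z)) 1 P).toReal := by
    rw [eLpNorm_one_eq_lintegral_enorm, ← integral_norm_eq_lintegral_enorm
      (Lp.aestronglyMeasurable _)]
    refine integral_congr_ae ?_
    filter_upwards [Lp.coeFn_sub Y Z] with ω hω
    rw [hω, Pi.sub_apply, Real.norm_eq_abs]
  rw [h1, Lp.norm_def]
  exact ENNReal.toReal_mono (Lp.eLpNorm_ne_top _)
    (eLpNorm_le_eLpNorm_of_exponent_le (by norm_num) (Lp.aestronglyMeasurable _))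

theorem Lp.integrable_two (Y : Lp ℝ 2 P) : Integrable Y P :=
  (Lp.memLp Y).integrable (by norm_num)

theorem lipschitzWith_integral_Lp_two : LipschitzWith 1 (fun Y : Lp ℝ 2 P => ∫ ω, Y ω ∂P) := by
  refine LipschitzWith.of_dist_le_mul fun Y Z => ?_
  rw [NNReal.coe_one, one_mul, Real.dist_eq, dist_eq_norm,
    ← integral_sub (Lp.integrable_two Y) (Lp.integrable_two Z)]
  exact abs_integral_le_integral_abs.trans (integral_abs_sub_le_norm_sub Y Z)

omit [IsProbabilityMeasure P] in
theorem integral_sq_Lp_two (Y : Lp ℝ 2 P) : ∫ ω, Y ω ^ 2 ∂P = ‖Y‖ ^ 2 := by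
  rw [← real_inner_self_eq_norm_sq, L2.inner_def]
  simp [sq]

theorem continuous_charFun_map_Lp_two (t : ℝ) :
    Continuous (fun Y : Lp ℝ 2 P => charFun (P.map Y) t) := by
  have hcf : ∀ Y : Lp ℝ 2 P,
      charFun (P.map Y) t = ∫ ω, Complex.exp ((t * Y ω : ℝ) * Complex.I) ∂P := by
    intro Y
    rw [charFun_apply_real, integral_map (Lp.aestronglyMeasurable Y).aemeasurable
      (Measurable.aestronglyMeasurable (by fun_prop))]
    simp
  have hm : ∀ Y : Lp ℝ 2 P, Integrable (fun ω => Complex.exp ((t * Y ω : ℝ) * Complex.I)) P := by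
    intro Y
    refine Integrable.of_bound (Measurable.aestronglyMeasurable ?_) 1
      (Filter.Eventually.of_forall fun ω => (Complex.norm_exp_ofReal_mul_I _).le)
    have := (Lp.stronglyMeasurable Y).measurable
    fun_prop
  refine LipschitzWith.continuous (K := ‖t‖₊) (LipschitzWith.of_dist_le_mul fun Y Z => ?_)
  rw [hcf, hcf, dist_eq_norm, dist_eq_norm, ← integral_sub (hm Y) (hm Z)]
  have hpt : ∀ ω, ‖Complex.exp ((t * Y ω : ℝ) * Complex.I) -
      Complex.exp ((t * Z ω : ℝ) * Complex.I)‖ ≤ |t| * |Y ω - Z ω| := by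
    intro ω
    have := Real.norm_exp_I_mul_ofReal_sub_one_le (x := t * Y ω - t * Z ω)
    have e : Complex.exp ((t * Y ω : ℝ) * Complex.I) - Complex.exp ((t * Z ω : ℝ) * Complex.I) =
        Complex.exp ((t * Z ω : ℝ) * Complex.I) *
          (Complex.exp (Complex.I * ((t * Y ω - t * Z ω : ℝ) : ℂ)) - 1) := by
      rw [mul_sub, mul_one, ← Complex.exp_add]
      congr 2
      push_cast
      ring
    rw [e, norm_mul, Complex.norm_exp_ofReal_mul_I, one_mul, ← abs_mul, mul_sub]
    exact this
  refine (norm_integral_le_of_norm_le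
    (((Lp.integrable_two Y).sub (Lp.integrable_two Z)).abs.const_mul |t|)
    (Filter.Eventually.of_forall hpt)).trans ?_
  rw [integral_const_mul]
  exact mul_le_mul_of_nonneg_left (integral_abs_sub_le_norm_sub Y Z) (abs_nonneg t)

/-- Being centered Gaussian means having mean `0` and characteristic function `exp (-t² ‖Y‖² / 2)`.
Every quantity in these equations is continuous in `Y` for the `L²` norm. -/
theorem isClosed_centered_gaussian_Lp_two :
    IsClosed {Y : Lp ℝ 2 P | HasGaussianLaw Y P ∧ ∫ ω, Y ω ∂P = 0} := by
  have h : {Y : Lp ℝ 2 P | HasGaussianLaw Y P ∧ ∫ ω, Y ω ∂P = 0} =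
      {Y : Lp ℝ 2 P | ∫ ω, Y ω ∂P = 0} ∩
        ⋂ t : ℝ, {Y : Lp ℝ 2 P | charFun (P.map Y) t =
          Complex.exp (-((t ^ 2 * ‖Y‖ ^ 2 : ℝ) : ℂ) / 2)} := by
    ext Y
    simp only [Set.mem_ofPred_eq, Set.mem_inter_iff, Set.mem_iInter]
    rw [hasGaussianLaw_iff_charFun_map_eq (Lp.aestronglyMeasurable Y).aemeasurable, and_comm]
    refine and_congr_right fun h0 => forall_congr' fun t => ?_
    have h1 : ∫ ω, inner ℝ t (Y ω) ∂P = 0 := by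
      simp only [RCLike.inner_apply, conj_trivial]
      rw [integral_mul_const, h0, zero_mul]
    have h2 : Var[fun ω => inner ℝ t (Y ω); P] = t ^ 2 * ‖Y‖ ^ 2 := by
      rw [variance_of_integral_eq_zero _ h1, ← integral_sq_Lp_two, ← integral_const_mul]
      · simp only [RCLike.inner_apply, conj_trivial, mul_pow]
        simp_rw [mul_comm]
      · simp only [RCLike.inner_apply, conj_trivial]
        exact (Lp.aestronglyMeasurable Y).aemeasurable.mul_const t
    rw [h1, h2]
    simp [neg_div]
  rw [h]
  refine (isClosed_eq lipschitzWith_integral_Lp_two.continuous continuous_const).inter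
    (isClosed_iInter fun t => isClosed_eq (continuous_charFun_map_Lp_two t) ?_)
  fun_prop

end GaussianConstruction

/-- The isonormal Gaussian process of a Hilbert space. -/
theorem exists_isonormal (H : Type) [NormedAddCommGroup H] [InnerProductSpace ℝ H]
    [CompleteSpace H] :
    ∃ (Ω : Type) (_ : MeasurableSpace Ω) (P : Measure Ω) (_ : IsProbabilityMeasure P)
      (W : H →ₗᵢ[ℝ] Lp ℝ 2 P), ∀ h, HasGaussianLaw (W h) P ∧ ∫ ω, W h ω ∂P = 0 := by
  obtain ⟨w, b, -⟩ := exists_hilbertBasis ℝ H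
  -- The probability space is a product of standard normal laws, one coordinate for each vector of a
  -- Hilbert basis.
  set μ : Measure (w → ℝ) := Measure.infinitePi (fun _ : w => gaussianReal 0 1) with hμ
  have hlaw : ∀ i : w, μ.map (fun x => x i) = gaussianReal 0 1 := fun i =>
    (measurePreserving_eval_infinitePi (fun _ : w => gaussianReal 0 1) i).map_eq
  have hg : ∀ i : w, HasGaussianLaw (fun x : w → ℝ => x i) μ := fun i =>
    ⟨by rw [hlaw]; infer_instance⟩
  have hmem : ∀ i : w, MemLp (fun x : w → ℝ => x i) 2 μ := fun i => (hg i).memLp_two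
  have hmean : ∀ i : w, ∫ x, x i ∂μ = 0 := fun i => by
    have := integral_map (μ := μ) (φ := fun x : w → ℝ => x i) (f := fun y : ℝ => y)
      (measurable_pi_apply i).aemeasurable (Measurable.aestronglyMeasurable (by fun_prop))
    rw [← this, hlaw, integral_id_gaussianReal]
  have hind : iIndepFun (fun (i : w) (x : w → ℝ) => x i) μ :=
    iIndepFun_infinitePi (X := fun _ : w => fun y : ℝ => y) (fun _ => measurable_id)
  set v : w → Lp ℝ 2 μ := fun i => (hmem i).toLp _ with hv
  have hinner : ∀ i j, inner ℝ (v i) (v j) = ∫ x, x i * x j ∂μ := by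
    intro i j
    rw [L2.inner_def]
    refine integral_congr_ae ?_
    filter_upwards [(hmem i).coeFn_toLp, (hmem j).coeFn_toLp] with x hx hx'
    simp only [hv]
    rw [hx, hx']
    simp [mul_comm]
  have hon : Orthonormal ℝ v := by
    classical
    rw [orthonormal_iff_ite]
    intro i j
    rw [hinner]
    split_ifs with hij
    · subst hij
      have h1 : Var[fun x : w → ℝ => x i; μ] = 1 := by
        have := variance_map (μ := μ) (X := fun y : ℝ => y) (Y := fun x : w → ℝ => x i)
          (by fun_prop) (measurable_pi_apply i).aemeasurable
        rw [hlaw] at this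
        simpa [Function.comp_def] using this.symm
      rw [variance_of_integral_eq_zero (measurable_pi_apply i).aemeasurable (hmean i)] at h1
      simpa [sq] using h1
    · have h1 := (hind.indepFun hij).covariance_eq_zero (hmem i) (hmem j)
      rw [covariance_eq_sub (hmem i) (hmem j), hmean, zero_mul, sub_zero] at h1
      exact h1
  have hfam : OrthogonalFamily ℝ (fun _ : w => ℝ)
      fun i => LinearIsometry.toSpanSingleton ℝ (Lp ℝ 2 μ) (hon.1 i) :=
    hon.orthogonalFamily
  refine ⟨w → ℝ, inferInstance, μ, inferInstance,
    hfam.linearIsometry.comp b.repr.toLinearIsometry, fun h => ?_⟩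
  -- `W h` is the `L²` limit of finite linear combinations of independent standard normal
  -- coordinates, and the centered Gaussian variables form a closed set.
  refine isClosed_centered_gaussian_Lp_two.mem_of_tendsto
    (hfam.hasSum_linearIsometry (b.repr h)) (Filter.Eventually.of_forall fun s => ?_)
  have hae : (⇑(∑ i ∈ s, LinearIsometry.toSpanSingleton ℝ (Lp ℝ 2 μ) (hon.1 i) (b.repr h i)) :
      (w → ℝ) → ℝ) =ᵐ[μ] fun x => ∑ i ∈ s, b.repr h i * x i := by
    have h1 := Lp.coeFn_finsetSum s
      (fun i => LinearIsometry.toSpanSingleton ℝ (Lp ℝ 2 μ) (hon.1 i) (b.repr h i))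
    have h2 : ∀ᵐ x ∂μ, ∀ i ∈ s,
        LinearIsometry.toSpanSingleton ℝ (Lp ℝ 2 μ) (hon.1 i) (b.repr h i) x =
          b.repr h i * x i := by
      rw [Finset.eventually_all]
      intro i _
      filter_upwards [Lp.coeFn_smul (b.repr h i) (v i), (hmem i).coeFn_toLp] with x hx hx'
      simp only [LinearIsometry.toSpanSingleton_apply]
      rw [hx, Pi.smul_apply, hx', smul_eq_mul]
    filter_upwards [h1, h2] with x hx hx'
    rw [hx, Finset.sum_apply]
    exact Finset.sum_congr rfl hx'
  constructor
  · refine HasGaussianLaw.congr ?_ hae.symm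
    have h1 : HasGaussianLaw (fun (x : w → ℝ) (i : s) => x i) μ :=
      iIndepFun.hasGaussianLaw (fun i => hg i) (hind.precomp Subtype.val_injective)
    have h2 := h1.map_fun (∑ i : s, (b.repr h i) • ContinuousLinearMap.proj (R := ℝ) i)
    refine h2.congr (Filter.Eventually.of_forall fun x => ?_)
    simp only [sum_apply, smul_apply,
      ContinuousLinearMap.proj_apply, smul_eq_mul]
    exact s.sum_coe_sort (fun i => b.repr h i * x i)
  · rw [integral_congr_ae hae, integral_finsetSum s fun i _ =>
      ((hmem i).integrable (by norm_num)).const_mul _]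
    refine Finset.sum_eq_zero fun i _ => ?_
    rw [integral_const_mul, hmean, mul_zero]

theorem isGaussianProcess_of_linearMap_Lp {V Ω : Type*} [AddCommGroup V] [Module ℝ V]
    [MeasurableSpace Ω] {P : Measure Ω} [IsProbabilityMeasure P] (T : V →ₗ[ℝ] Lp ℝ 2 P)
    (hT : ∀ x, HasGaussianLaw (T x) P) : IsGaussianProcess (fun x => ⇑(T x)) P := by
  refine ⟨fun I => ⟨isGaussian_of_isGaussian_map fun L => ?_⟩⟩
  have hm : Measurable fun ω => I.restrict fun x => T x ω :=
    measurable_pi_lambda _ fun i => (Lp.stronglyMeasurable (T i)).measurable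
  rw [Measure.map_map (by fun_prop) hm]
  classical
  -- By linearity of `T`, any linear functional of a finite-dimensional marginal is almost surely
  -- the image of a single vector, hence Gaussian.
  have hL : ⇑(T (∑ i : I, L (Pi.single i 1) • (i : V))) =ᵐ[P]
      L ∘ fun ω => I.restrict fun x => T x ω := by
    rw [map_sum]
    have h1 := Lp.coeFn_finsetSum Finset.univ (fun i : I => T (L (Pi.single i 1) • (i : V)))
    have h2 : ∀ᵐ ω ∂P, ∀ i : I, T (L (Pi.single i 1) • (i : V)) ω =
        L (Pi.single i 1) * T i ω := by
      rw [ae_all_iff]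
      intro i
      rw [map_smul]
      filter_upwards [Lp.coeFn_smul (L (Pi.single i 1)) (T i)] with ω hω
      rw [hω, Pi.smul_apply, smul_eq_mul]
    filter_upwards [h1, h2] with ω hω hω'
    rw [hω, Finset.sum_apply, Function.comp_apply]
    conv_rhs => rw [← Finset.univ_sum_single (I.restrict fun x => T x ω), map_sum]
    refine Finset.sum_congr rfl fun i _ => ?_
    rw [hω' i]
    have : (Pi.single i (I.restrict (fun x => T x ω) i) : I → ℝ) =
        (T i ω) • Pi.single i 1 := by
      rw [← Pi.single_smul]
      simp
    rw [this, map_smul, smul_eq_mul, mul_comm]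
  rw [← Measure.map_congr hL]
  exact (hT _).isGaussian_map

theorem exists_gaussianProcess_of_bilinForm {V : Type} [AddCommGroup V] [Module ℝ V]
    (B : LinearMap.BilinForm ℝ V) (hsymm : ∀ x y, B x y = B y x) (hnonneg : ∀ x, 0 ≤ B x x) :
    ∃ (Ω : Type) (_ : MeasurableSpace Ω) (P : Measure Ω) (_ : IsProbabilityMeasure P)
      (Φ : V → Ω → ℝ), (∀ x, Measurable (Φ x)) ∧ IsGaussianProcess Φ P ∧
        (∀ x, ∫ ω, Φ x ω ∂P = 0) ∧ ∀ x y, cov[Φ x, Φ y; P] = B x y := by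
  let core : PreInnerProductSpace.Core ℝ V :=
    { inner := fun x y => B x y
      conj_inner_symm := fun x y => hsymm y x
      re_inner_nonneg := hnonneg
      add_left := fun x y z => by simp
      smul_left := fun x y r => by simp }
  let _ : SeminormedAddCommGroup V := InnerProductSpace.Core.toSeminormedAddCommGroup (𝕜 := ℝ)
  let _ : InnerProductSpace ℝ V := InnerProductSpace.ofCore core
  -- The form may be degenerate, so `V` is only seminormed; its completion is separated and is a
  -- genuine Hilbert space.
  obtain ⟨Ω, mΩ, P, hP, W, hW⟩ := exists_isonormal (UniformSpace.Completion V)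
  let T : V →ₗ[ℝ] Lp ℝ 2 P :=
    W.toLinearMap ∘ₗ (UniformSpace.Completion.toComplₗᵢ (𝕜 := ℝ) (E := V)).toLinearMap
  have hT : ∀ x, T x = W (x : UniformSpace.Completion V) := fun x => rfl
  refine ⟨Ω, mΩ, P, hP, fun x => ⇑(T x), fun x => (Lp.stronglyMeasurable (T x)).measurable,
    isGaussianProcess_of_linearMap_Lp T fun x => (hW _).1, fun x => (hW _).2, fun x y => ?_⟩
  rw [covariance_eq_sub (Lp.memLp _) (Lp.memLp _), hT, hT, (hW _).2, zero_mul, sub_zero]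
  have h : inner ℝ (W (x : UniformSpace.Completion V)) (W (y : UniformSpace.Completion V)) =
      B x y := by
    rw [LinearIsometry.inner_map_map, UniformSpace.Completion.inner_coe]
    rfl
  rw [← h, L2.inner_def]
  simp [mul_comm]

/-! ### Versions with linear continuous paths -/

section Version

variable {Ω : Type*} [MeasurableSpace Ω] {P : Measure Ω}

theorem IsCenteredGaussianOn.memLp_two {K : LipSpace → LipSpace → ℝ} {Φ : LipSpace → Ω → ℝ}
    (hΦ : IsCenteredGaussianOn P K Φ) (f : LipSpace) : MemLp (Φ f) 2 P :=
  (hΦ.gaussian.hasGaussianLaw_eval f).memLp_two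

variable [IsProbabilityMeasure P]

theorem IsCenteredGaussianOn.integral_mul {K : LipSpace → LipSpace → ℝ} {Φ : LipSpace → Ω → ℝ}
    (hΦ : IsCenteredGaussianOn P K Φ) (f g : LipSpace) : ∫ ω, Φ f ω * Φ g ω ∂P = K f g := by
  rw [← hΦ.cov_eq f g, covariance_eq_sub (hΦ.memLp_two f) (hΦ.memLp_two g), hΦ.centered, zero_mul,
    sub_zero]
  rfl

theorem IsCenteredGaussianOn.inner_toLp {K : LipSpace → LipSpace → ℝ} {Φ : LipSpace → Ω → ℝ}
    (hΦ : IsCenteredGaussianOn P K Φ) (f g : LipSpace) :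
    inner ℝ ((hΦ.memLp_two f).toLp _) ((hΦ.memLp_two g).toLp _) = K f g := by
  rw [← hΦ.integral_mul, L2.inner_def]
  refine integral_congr_ae ?_
  filter_upwards [(hΦ.memLp_two f).coeFn_toLp, (hΦ.memLp_two g).coeFn_toLp] with ω h1 h2
  rw [h1, h2]
  simp [mul_comm]

/-- A centered Gaussian process whose covariance is a bilinear form, as a linear map into `L²`. -/
def IsCenteredGaussianOn.toLpLinear {B : LinearMap.BilinForm ℝ LipSpace} {Φ : LipSpace → Ω → ℝ}
    (hΦ : IsCenteredGaussianOn P (fun f g => B f g) Φ) : LipSpace →ₗ[ℝ] Lp ℝ 2 P where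
  toFun f := (hΦ.memLp_two f).toLp _
  map_add' f g := by
    -- The squared `L²` norm of the defect expands into values of `B` and cancels by bilinearity;
    -- the process itself is not assumed linear.
    rw [← sub_eq_zero, ← inner_self_eq_zero (𝕜 := ℝ)]
    simp only [inner_sub_left, inner_sub_right, inner_add_left, inner_add_right, hΦ.inner_toLp,
      map_add, LinearMap.add_apply]
    ring
  map_smul' a f := by
    rw [← sub_eq_zero, ← inner_self_eq_zero (𝕜 := ℝ)]
    simp only [inner_sub_left, inner_sub_right, real_inner_smul_left, real_inner_smul_right,
      hΦ.inner_toLp, map_smul, LinearMap.smul_apply, smul_eq_mul, RingHom.id_apply]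
    ring

theorem IsCenteredGaussianOn.coeFn_toLpLinear {B : LinearMap.BilinForm ℝ LipSpace}
    {Φ : LipSpace → Ω → ℝ} (hΦ : IsCenteredGaussianOn P (fun f g => B f g) Φ) (f : LipSpace) :
    ⇑(hΦ.toLpLinear f) =ᵐ[P] Φ f := (hΦ.memLp_two f).coeFn_toLp

theorem IsCenteredGaussianOn.norm_sq_toLpLinear {B : LinearMap.BilinForm ℝ LipSpace}
    {Φ : LipSpace → Ω → ℝ} (hΦ : IsCenteredGaussianOn P (fun f g => B f g) Φ) (f : LipSpace) :
    ‖hΦ.toLpLinear f‖ ^ 2 = B f f := by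
  rw [← real_inner_self_eq_norm_sq]
  exact hΦ.inner_toLp f f

theorem IsCenteredGaussianOn.lintegral_enorm_le {B : LinearMap.BilinForm ℝ LipSpace}
    {Φ : LipSpace → Ω → ℝ} (hΦ : IsCenteredGaussianOn P (fun f g => B f g) Φ) (f : LipSpace) :
    ∫⁻ ω, ‖Φ f ω‖ₑ ∂P ≤ ENNReal.ofReal √(B f f) := by
  have h1 : ∫⁻ ω, ‖Φ f ω‖ₑ ∂P = eLpNorm (Φ f) 1 P := eLpNorm_one_eq_lintegral_enorm.symm
  have h2 : eLpNorm (Φ f) 2 P = ENNReal.ofReal ‖hΦ.toLpLinear f‖ := by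
    rw [Lp.norm_def, ENNReal.ofReal_toReal (Lp.eLpNorm_ne_top _)]
    exact eLpNorm_congr_ae (hΦ.coeFn_toLpLinear f).symm
  rw [← hΦ.norm_sq_toLpLinear, Real.sqrt_sq (norm_nonneg _), ← h2, h1]
  exact eLpNorm_le_eLpNorm_of_exponent_le (by norm_num) (hΦ.memLp_two f).1

/-- A centered Gaussian process has a version with linear continuous paths as soon as the index
functions have an expansion `f = ∑ cᵢ(f) eᵢ`, convergent for the covariance seminorm, with
`|cᵢ(f)| ≤ wᵢ ‖f‖` and `∑ wᵢ √(B eᵢ eᵢ) < ∞`. -/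
theorem IsCenteredGaussianOn.exists_version {B : LinearMap.BilinForm ℝ LipSpace}
    {Φ : LipSpace → Ω → ℝ} (hΦ : IsCenteredGaussianOn P (fun f g => B f g) Φ)
    {ι : Type*} [Countable ι] (e : ι → LipSpace) (c : ι → LipSpace →ₗ[ℝ] ℝ) (w : ι → ℝ)
    (hw : ∀ i, 0 ≤ w i) (hc : ∀ i f, |c i f| ≤ w i * ‖f‖)
    (hsum : Summable fun i => w i * √(B (e i) (e i)))
    (S : ℕ → Finset ι) (hS : Filter.Tendsto S Filter.atTop Filter.atTop)
    (happrox : ∀ f, Filter.Tendsto (fun N => B (f - ∑ i ∈ S N, c i f • e i)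
      (f - ∑ i ∈ S N, c i f • e i)) Filter.atTop (nhds 0)) :
    ∃ Ψ : LipSpace → Ω → ℝ, IsVersion P Ψ Φ ∧
      ∀ ω, IsLinearMap ℝ (fun f => Ψ f ω) ∧ Continuous (fun f => Ψ f ω) := by
  classical
  have hΦe : ∀ f, Measurable fun ω => ‖Φ f ω‖ₑ := fun f => (hΦ.measurable f).enorm
  -- On `A` the series converges absolutely for all `f` at once. The random sum has expectation at
  -- most `∑ wᵢ √(B eᵢ eᵢ) < ∞`, so `A` has full measure.
  set A : Set Ω := {ω | ∑' i, ENNReal.ofReal (w i) * ‖Φ (e i) ω‖ₑ < ⊤} with hA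
  have htm : Measurable fun ω => ∑' i, ENNReal.ofReal (w i) * ‖Φ (e i) ω‖ₑ :=
    Measurable.tsum fun i => (hΦe _).const_mul _
  have hAm : MeasurableSet A := measurableSet_lt htm measurable_const
  have hAae : ∀ᵐ ω ∂P, ω ∈ A := by
    refine ae_lt_top htm (ne_of_lt ?_)
    rw [lintegral_tsum fun i => ((hΦe _).const_mul _).aemeasurable]
    calc ∑' i, ∫⁻ ω, ENNReal.ofReal (w i) * ‖Φ (e i) ω‖ₑ ∂P
        ≤ ∑' i, ENNReal.ofReal (w i * √(B (e i) (e i))) := by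
          refine ENNReal.tsum_le_tsum fun i => ?_
          rw [lintegral_const_mul _ (hΦe _), ENNReal.ofReal_mul (hw i)]
          gcongr
          exact hΦ.lintegral_enorm_le _
      _ < ⊤ := hsum.tsum_ofReal_lt_top
  have hAsum : ∀ ω ∈ A, Summable fun i => w i * |Φ (e i) ω| := by
    intro ω hω
    have h1 : ∑' i, ENNReal.ofReal (w i * |Φ (e i) ω|) ≠ ⊤ := by
      refine ne_of_lt (lt_of_le_of_lt (ENNReal.tsum_le_tsum fun i => ?_) hω)
      rw [ENNReal.ofReal_mul (hw i), ← Real.norm_eq_abs, ofReal_norm]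
    have h2 := ENNReal.summable_toReal h1
    refine h2.congr fun i => ?_
    rw [ENNReal.toReal_ofReal (mul_nonneg (hw i) (abs_nonneg _))]
  have hle : ∀ f i ω, ‖c i f * Φ (e i) ω‖ ≤ ‖f‖ * (w i * |Φ (e i) ω|) := by
    intro f i ω
    rw [norm_mul, Real.norm_eq_abs, Real.norm_eq_abs]
    calc |c i f| * |Φ (e i) ω| ≤ w i * ‖f‖ * |Φ (e i) ω| :=
          mul_le_mul_of_nonneg_right (hc i f) (abs_nonneg _)
      _ = _ := by ring
  have hAf : ∀ f, ∀ ω ∈ A, Summable fun i => c i f * Φ (e i) ω := fun f ω hω =>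
    Summable.of_norm_bounded ((hAsum ω hω).mul_left ‖f‖) fun i => hle f i ω
  -- Setting the version to zero off `A` makes every path, not just almost every one, linear and
  -- continuous.
  set Ψ : LipSpace → Ω → ℝ := fun f => A.indicator fun ω => ∑' i, c i f * Φ (e i) ω with hΨ
  have hlim : ∀ f, ∀ ω ∈ A, Filter.Tendsto (fun N => ∑ i ∈ S N, c i f * Φ (e i) ω)
      Filter.atTop (nhds (Ψ f ω)) := by
    intro f ω hω
    simp only [hΨ, Set.indicator_of_mem hω]
    exact (hAf f ω hω).hasSum.comp hS
  refine ⟨Ψ, ⟨fun f => ?_, fun f => ?_⟩, fun ω => ?_⟩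
  · refine measurable_of_tendsto_metrizable
      (f := fun N => A.indicator fun ω => ∑ i ∈ S N, c i f * Φ (e i) ω) (fun N => ?_) ?_
    · exact (Finset.measurable_fun_sum _ fun i _ => (hΦ.measurable _).const_mul _).indicator hAm
    · rw [tendsto_pi_nhds]
      intro ω
      by_cases hω : ω ∈ A
      · simpa only [Set.indicator_of_mem hω] using hlim f ω hω
      · simp only [hΨ, Set.indicator_of_notMem hω]
        exact tendsto_const_nhds
  · have hLp : Filter.Tendsto (fun N => ∑ i ∈ S N, c i f • hΦ.toLpLinear (e i)) Filter.atTop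
        (nhds (hΦ.toLpLinear f)) := by
      rw [tendsto_iff_norm_sub_tendsto_zero]
      have h1 : ∀ N, ‖∑ i ∈ S N, c i f • hΦ.toLpLinear (e i) - hΦ.toLpLinear f‖ =
          √(B (f - ∑ i ∈ S N, c i f • e i) (f - ∑ i ∈ S N, c i f • e i)) := by
        intro N
        rw [← hΦ.norm_sq_toLpLinear, Real.sqrt_sq (norm_nonneg _), norm_sub_rev]
        simp only [map_sub, map_sum, map_smul]
      simp_rw [h1]
      have h2 := (Real.continuous_sqrt.tendsto 0).comp (happrox f)
      rwa [Real.sqrt_zero] at h2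
    -- The partial sums tend to `Φ f` in `L²`, hence almost surely along a subsequence, and to `Ψ f`
    -- pointwise on `A`; the two limits agree.
    obtain ⟨ns, hns, hae⟩ := (tendstoInMeasure_of_tendsto_Lp hLp).exists_seq_tendsto_ae
    have hsumae : ∀ᵐ ω ∂P, ∀ N, (∑ i ∈ S N, c i f • hΦ.toLpLinear (e i) : Lp ℝ 2 P) ω =
        ∑ i ∈ S N, c i f * Φ (e i) ω := by
      rw [ae_all_iff]
      intro N
      have h1 := Lp.coeFn_finsetSum (S N) (fun i => c i f • hΦ.toLpLinear (e i))
      have h2 : ∀ᵐ ω ∂P, ∀ i, (c i f • hΦ.toLpLinear (e i) : Lp ℝ 2 P) ω =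
          c i f * Φ (e i) ω := by
        rw [ae_all_iff]
        intro i
        filter_upwards [Lp.coeFn_smul (c i f) (hΦ.toLpLinear (e i)),
          hΦ.coeFn_toLpLinear (e i)] with ω h1 h2
        rw [h1, Pi.smul_apply, h2, smul_eq_mul]
      filter_upwards [h1, h2] with ω h1 h2
      rw [h1, Finset.sum_apply]
      exact Finset.sum_congr rfl fun i _ => h2 i
    filter_upwards [hae, hsumae, hAae, hΦ.coeFn_toLpLinear f] with ω h1 h2 h3 h4
    simp only [h2, h4] at h1
    exact tendsto_nhds_unique ((hlim f ω h3).comp hns.tendsto_atTop) h1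
  · by_cases hω : ω ∈ A
    · have hΨω : (fun f => Ψ f ω) = fun f => ∑' i, c i f * Φ (e i) ω := by
        funext f
        simp only [hΨ, Set.indicator_of_mem hω]
      rw [hΨω]
      have hlin : IsLinearMap ℝ fun f => ∑' i, c i f * Φ (e i) ω := by
        constructor
        · intro f g
          rw [← (hAf f ω hω).tsum_add (hAf g ω hω)]
          simp only [map_add, add_mul]
        · intro a f
          simp only [map_smul, smul_eq_mul]
          rw [← tsum_mul_left]
          simp only [mul_assoc]
      refine ⟨hlin, ?_⟩
      refine (LinearMap.mkContinuous hlin.mk' (∑' i, w i * |Φ (e i) ω|) fun f => ?_).continuous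
      rw [IsLinearMap.mk'_apply, mul_comm, ← tsum_mul_left]
      exact tsum_of_norm_bounded ((hAsum ω hω).mul_left ‖f‖).hasSum fun i => hle f i ω
    · have hΨω : (fun f => Ψ f ω) = fun _ => 0 := by
        funext f
        simp only [hΨ, Set.indicator_of_notMem hω]
      rw [hΨω]
      exact ⟨⟨fun _ _ => (add_zero 0).symm, fun a _ => (smul_zero a).symm⟩, continuous_const⟩

end Version

/-! ### The Faber–Schauder expansion of a Lipschitz function -/

namespace LipSpace

/-- Evaluation at a point. -/
def eval (x : ℝ) : LipSpace →ₗ[ℝ] ℝ where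
  toFun f := f x
  map_add' f g := add_apply f g x
  map_smul' a f := smul_apply a f x

theorem eval_apply (x : ℝ) (f : LipSpace) : eval x f = f x := rfl

theorem lip_le_norm (f : LipSpace) : f.lip ≤ ‖f‖ := by
  rw [norm_def]
  linarith [abs_nonneg (f 0)]

/-- The tent function of height `1` on the dyadic interval `[j / 2 ^ k, (j + 1) / 2 ^ k]`. -/
def tent (k : ℕ) (j : ℤ) : LipSpace :=
  ⟨fun x => max 0 (1 - |2 * (2 ^ k * x - j) - 1|), 2 * 2 ^ k, by
    refine LipschitzWith.of_dist_le_mul fun x y => ?_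
    rw [Real.dist_eq, Real.dist_eq]
    refine (abs_max_sub_max_le_max _ _ _ _).trans ?_
    rw [sub_self, abs_zero, max_eq_right (abs_nonneg _), sub_sub_sub_cancel_left]
    refine (abs_abs_sub_abs_le_abs_sub _ _).trans ?_
    have : (2 * (2 ^ k * y - j) - 1 - (2 * (2 ^ k * x - j) - 1) : ℝ) = -(2 * 2 ^ k * (x - y)) := by
      ring
    rw [this, abs_neg, abs_mul, abs_of_nonneg (by positivity : (0 : ℝ) ≤ 2 * 2 ^ k)]
    simp⟩

theorem tent_apply (k : ℕ) (j : ℤ) (x : ℝ) :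
    tent k j x = max 0 (1 - |2 * (2 ^ k * x - j) - 1|) := rfl

/-- The function that rises from `0` to `1` on `[i, i + 1]`. -/
def hinge (i : ℤ) : LipSpace :=
  ⟨fun x => max 0 (min 1 (x - i)), 1, by
    refine LipschitzWith.of_dist_le_mul fun x y => ?_
    rw [Real.dist_eq, Real.dist_eq]
    refine (abs_max_sub_max_le_max _ _ _ _).trans ?_
    rw [sub_self, abs_zero, max_eq_right (abs_nonneg _)]
    refine (abs_min_sub_min_le_max _ _ _ _).trans ?_
    simp⟩

theorem hinge_apply (i : ℤ) (x : ℝ) : hinge i x = max 0 (min 1 (x - i)) := rfl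

theorem tent_nonneg (k : ℕ) (j : ℤ) (x : ℝ) : 0 ≤ tent k j x := le_max_left _ _

theorem tent_le_one (k : ℕ) (j : ℤ) (x : ℝ) : tent k j x ≤ 1 :=
  max_le zero_le_one (by linarith [abs_nonneg (2 * (2 ^ k * x - j) - 1 : ℝ)])

theorem tent_eq_zero_of_le {k : ℕ} {j : ℤ} {x : ℝ} (h : 2 ^ k * x ≤ j) : tent k j x = 0 := by
  refine max_eq_left ?_
  linarith [neg_le_abs (2 * (2 ^ k * x - j) - 1 : ℝ)]

theorem tent_eq_zero_of_ge {k : ℕ} {j : ℤ} {x : ℝ} (h : (j : ℝ) + 1 ≤ 2 ^ k * x) :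
    tent k j x = 0 := by
  refine max_eq_left ?_
  linarith [le_abs_self (2 * (2 ^ k * x - j) - 1 : ℝ)]

theorem tent_eq_zero_of_floor_ne {k : ℕ} {j : ℤ} {x : ℝ} (h : ⌊2 ^ k * x⌋ ≠ j) :
    tent k j x = 0 := by
  rcases lt_or_gt_of_ne h with h | h
  · exact tent_eq_zero_of_le (Int.floor_lt.1 h).le
  · refine tent_eq_zero_of_ge ?_
    have := Int.le_floor.1 (Int.add_one_le_iff.2 h)
    push_cast at this
    exact this

/-- The coefficient of `tent k j` in the expansion of a function. -/
def tentCoef (k : ℕ) (j : ℤ) : LipSpace →ₗ[ℝ] ℝ :=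
  eval ((2 * j + 1) / 2 ^ (k + 1)) - (2 : ℝ)⁻¹ • (eval (j / 2 ^ k) + eval ((j + 1) / 2 ^ k))

theorem tentCoef_apply (k : ℕ) (j : ℤ) (f : LipSpace) : tentCoef k j f =
    f ((2 * j + 1) / 2 ^ (k + 1)) - 2⁻¹ * (f (j / 2 ^ k) + f ((j + 1) / 2 ^ k)) := rfl

/-- The coefficient of `hinge i` in the expansion of a function. -/
def hingeCoef (i : ℤ) : LipSpace →ₗ[ℝ] ℝ := eval (i + 1) - eval i

theorem hingeCoef_apply (i : ℤ) (f : LipSpace) : hingeCoef i f = f (i + 1) - f i := rfl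

theorem abs_hingeCoef_le (i : ℤ) (f : LipSpace) : |hingeCoef i f| ≤ ‖f‖ := by
  rw [hingeCoef_apply]
  refine (f.abs_sub_le_lip _ _).trans ?_
  simpa using f.lip_le_norm

theorem abs_tentCoef_le (k : ℕ) (j : ℤ) (f : LipSpace) :
    |tentCoef k j f| ≤ (1 / 2) ^ k * ‖f‖ := by
  rw [tentCoef_apply]
  have h1 := f.abs_sub_le_lip ((2 * j + 1) / 2 ^ (k + 1)) (j / 2 ^ k)
  have h2 := f.abs_sub_le_lip ((2 * j + 1) / 2 ^ (k + 1)) ((j + 1) / 2 ^ k)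
  -- The midpoint of a dyadic cell of level `k` is at distance `2^(-k-1)` from both ends.
  have e1 : ((2 * j + 1) / 2 ^ (k + 1) - j / 2 ^ k : ℝ) = (1 / 2) * (1 / 2) ^ k := by
    rw [pow_succ, one_div_pow]
    field_simp
    ring
  have e2 : ((2 * j + 1) / 2 ^ (k + 1) - (j + 1) / 2 ^ k : ℝ) = -((1 / 2) * (1 / 2) ^ k) := by
    rw [pow_succ, one_div_pow]
    field_simp
    ring
  have hp : (0 : ℝ) < (1 / 2) ^ k := by positivity
  have ha : |(1 / 2 : ℝ) * (1 / 2) ^ k| = 1 / 2 * (1 / 2) ^ k := abs_of_nonneg (by positivity)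
  rw [e1, ha] at h1
  rw [e2, abs_neg, ha] at h2
  have h3 : f.lip * (1 / 2 * (1 / 2) ^ k) ≤ (1 / 2) ^ k * ‖f‖ := by
    nlinarith [f.lip_le_norm, f.lip_nonneg, mul_le_mul_of_nonneg_left f.lip_le_norm hp.le,
      mul_nonneg f.lip_nonneg hp.le]
  rw [abs_le] at *
  constructor <;> linarith [h1.1, h1.2, h2.1, h2.2]

/-- Piecewise linear interpolation on the grid `2⁻ᵏ ℤ`. -/
def interp (k : ℕ) (f : LipSpace) (x : ℝ) : ℝ :=
  (1 - Int.fract (2 ^ k * x)) * f (⌊2 ^ k * x⌋ / 2 ^ k) +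
    Int.fract (2 ^ k * x) * f ((⌊2 ^ k * x⌋ + 1) / 2 ^ k)

theorem interp_eq {k : ℕ} (f : LipSpace) {x s : ℝ} {j : ℤ} (hs0 : 0 ≤ s) (hs1 : s < 1)
    (h : 2 ^ k * x = j + s) :
    interp k f x = (1 - s) * f (j / 2 ^ k) + s * f ((j + 1) / 2 ^ k) := by
  have hf : ⌊(2 : ℝ) ^ k * x⌋ = j := Int.floor_eq_iff.2 ⟨by linarith, by linarith⟩
  have hfr : Int.fract ((2 : ℝ) ^ k * x) = s := by
    rw [Int.fract, hf, h]
    ring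
  rw [interp, hf, hfr]

/-- Refining the grid changes the interpolant on each cell by a multiple of its tent, the multiple
being the interpolation error at the midpoint. Only the cell containing `x` contributes. -/
theorem interp_succ (k : ℕ) (f : LipSpace) (x : ℝ) : interp (k + 1) f x = interp k f x +
    tentCoef k ⌊2 ^ k * x⌋ f * tent k ⌊2 ^ k * x⌋ x := by
  obtain ⟨j, s, hs0, hs1, h⟩ : ∃ (j : ℤ) (s : ℝ), 0 ≤ s ∧ s < 1 ∧ 2 ^ k * x = j + s :=
    ⟨⌊2 ^ k * x⌋, Int.fract (2 ^ k * x), Int.fract_nonneg _, Int.fract_lt_one _,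
      (Int.floor_add_fract _).symm⟩
  have hf : ⌊(2 : ℝ) ^ k * x⌋ = j := Int.floor_eq_iff.2 ⟨by linarith, by linarith⟩
  have hp : (2 : ℝ) ^ k ≠ 0 := by positivity
  rw [interp_eq f hs0 hs1 h, hf, tent_apply, tentCoef_apply, h, add_sub_cancel_left]
  rcases lt_or_ge s (1 / 2) with hs | hs
  · have h2 : (2 : ℝ) ^ (k + 1) * x = ((2 * j : ℤ) : ℝ) + 2 * s := by
      rw [pow_succ]
      push_cast
      linarith
    rw [interp_eq f (by linarith) (by linarith) h2, abs_of_nonpos (by linarith),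
      max_eq_right (by linarith)]
    have e1 : (((2 * j : ℤ) : ℝ) / 2 ^ (k + 1)) = j / 2 ^ k := by
      push_cast
      rw [pow_succ]
      field_simp
    rw [e1]
    push_cast
    ring
  · have h2 : (2 : ℝ) ^ (k + 1) * x = ((2 * j + 1 : ℤ) : ℝ) + (2 * s - 1) := by
      rw [pow_succ]
      push_cast
      linarith
    rw [interp_eq f (by linarith) (by linarith) h2, abs_of_nonneg (by linarith),
      max_eq_right (by linarith)]
    have e1 : ((((2 * j + 1 : ℤ) : ℝ) + 1) / 2 ^ (k + 1)) = (j + 1) / 2 ^ k := by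
      push_cast
      rw [pow_succ]
      field_simp
      ring
    rw [e1]
    push_cast
    ring

theorem interp_eq_add_sum (N : ℕ) (f : LipSpace) (x : ℝ) : interp N f x = interp 0 f x +
    ∑ k ∈ Finset.range N, tentCoef k ⌊2 ^ k * x⌋ f * tent k ⌊2 ^ k * x⌋ x := by
  induction N with
  | zero => simp
  | succ N ih => rw [Finset.sum_range_succ, interp_succ, ih, add_assoc]

theorem abs_sub_interp_le (N : ℕ) (f : LipSpace) (x : ℝ) :
    |f x - interp N f x| ≤ f.lip * (1 / 2) ^ N := by
  obtain ⟨j, s, hs0, hs1, h⟩ : ∃ (j : ℤ) (s : ℝ), 0 ≤ s ∧ s < 1 ∧ 2 ^ N * x = j + s :=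
    ⟨⌊2 ^ N * x⌋, Int.fract (2 ^ N * x), Int.fract_nonneg _, Int.fract_lt_one _,
      (Int.floor_add_fract _).symm⟩
  have hp : (2 : ℝ) ^ N ≠ 0 := by positivity
  have hq : (0 : ℝ) < (1 / 2) ^ N := by positivity
  rw [interp_eq f hs0 hs1 h]
  have hx : x = (j + s) / 2 ^ N := by
    rw [← h]
    field_simp
  have h1 := f.abs_sub_le_lip x (j / 2 ^ N)
  have h2 := f.abs_sub_le_lip x ((j + 1) / 2 ^ N)
  have e1 : x - j / 2 ^ N = s * (1 / 2) ^ N := by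
    rw [hx, one_div_pow]
    field_simp
    ring
  have e2 : x - (j + 1) / 2 ^ N = -((1 - s) * (1 / 2) ^ N) := by
    rw [hx, one_div_pow]
    field_simp
    ring
  have hb1 : s * (1 / 2) ^ N ≤ (1 / 2 : ℝ) ^ N := by nlinarith
  have hb2 : (1 - s) * (1 / 2) ^ N ≤ (1 / 2 : ℝ) ^ N := by nlinarith
  rw [e1, abs_of_nonneg (mul_nonneg hs0 hq.le)] at h1
  rw [e2, abs_neg, abs_of_nonneg (mul_nonneg (by linarith) hq.le)] at h2
  have h1' := h1.trans (mul_le_mul_of_nonneg_left hb1 f.lip_nonneg)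
  have h2' := h2.trans (mul_le_mul_of_nonneg_left hb2 f.lip_nonneg)
  have e : f x - ((1 - s) * f (j / 2 ^ N) + s * f ((j + 1) / 2 ^ N)) =
      (1 - s) * (f x - f (j / 2 ^ N)) + s * (f x - f ((j + 1) / 2 ^ N)) := by ring
  rw [e]
  refine (abs_add_le _ _).trans ?_
  rw [abs_mul, abs_mul, abs_of_nonneg hs0, abs_of_nonneg (by linarith : 0 ≤ 1 - s)]
  nlinarith [mul_le_mul_of_nonneg_left h1' (by linarith : 0 ≤ 1 - s),
    mul_le_mul_of_nonneg_left h2' hs0]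

/-- The hinges accumulate the increments of `f` from `a` onwards, which loses the constant `f a`;
past `b` the sum stays frozen, hence `min x b`. -/
theorem sum_hinge_eq (f : LipSpace) {x : ℝ} {a b : ℤ} (hab : a ≤ b) (hx : (a : ℝ) ≤ x) :
    ∑ i ∈ Finset.Ico a b, hingeCoef i f * hinge i x = interp 0 f (min x b) - f a := by
  have hint : ∀ m : ℤ, interp 0 f m = f m := fun m => by
    rw [interp_eq (k := 0) f (s := 0) (j := m) le_rfl zero_lt_one (by simp)]
    simp
  induction b, hab using Int.leInduction with
  | base => rw [Finset.Ico_self, Finset.sum_empty, min_eq_right hx, hint, sub_self]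
  | succ b hab ih =>
    rw [← Finset.insert_Ico_right_eq_Ico_add_one hab, Finset.sum_insert (by simp), ih,
      hingeCoef_apply, hinge_apply]
    push_cast
    rcases le_total x b with h | h
    · rw [min_eq_left h, min_eq_left (by linarith : x ≤ b + 1),
        min_eq_right (by linarith : x - b ≤ 1), max_eq_left (by linarith)]
      ring
    · rw [min_eq_right h, hint]
      rcases le_or_gt ((b : ℝ) + 1) x with h1 | h1
      · rw [min_eq_right h1, min_eq_left (by linarith), max_eq_right zero_le_one]
        have := hint (b + 1)
        push_cast at this
        rw [this]
        ring
      · rw [min_eq_left h1.le, min_eq_right (by linarith), max_eq_right (by linarith),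
          interp_eq (k := 0) f (s := x - b) (j := b) (by linarith) (by linarith) (by simp)]
        simp only [pow_zero, div_one]
        ring

theorem sum_tent_eq (c : ℤ → ℝ) (k N : ℕ) {x : ℝ} (hx : |x| ≤ N) :
    ∑ j ∈ Finset.Ico (-(N * 2 ^ k : ℤ)) (N * 2 ^ k), c j * tent k j x =
      c ⌊2 ^ k * x⌋ * tent k ⌊2 ^ k * x⌋ x := by
  obtain ⟨h1, h2⟩ := abs_le.1 hx
  have hp : (0 : ℝ) < 2 ^ k := by positivity
  refine Finset.sum_eq_single _ (fun j _ hj => ?_) fun h => ?_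
  · rw [tent_eq_zero_of_floor_ne hj.symm, mul_zero]
  · have hl : (-(N * 2 ^ k : ℤ)) ≤ ⌊(2 : ℝ) ^ k * x⌋ := by
      rw [Int.le_floor]
      push_cast
      nlinarith
    -- The cell of `x` can fall outside the half-open range only at `x = N`, where its tent vanishes
    -- at its left endpoint.
    have hu : (N * 2 ^ k : ℤ) ≤ ⌊(2 : ℝ) ^ k * x⌋ := by
      by_contra hlt
      exact h (Finset.mem_Ico.2 ⟨hl, not_le.1 hlt⟩)
    rw [tent_eq_zero_of_le, mul_zero]
    have hu' : ((N * 2 ^ k : ℤ) : ℝ) ≤ (⌊(2 : ℝ) ^ k * x⌋ : ℝ) := by exact_mod_cast hu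
    push_cast at hu'
    nlinarith

/-- The index set of the expansion: hinges at the integers and tents on the dyadic intervals. -/
abbrev SchauderIndex : Type := ℤ ⊕ (Σ _ : ℕ, ℤ)

/-- The functions of the expansion. -/
def schauder : SchauderIndex → LipSpace := Sum.elim hinge fun p => tent p.1 p.2

/-- The coefficients of the expansion. -/
def schauderCoef : SchauderIndex → LipSpace →ₗ[ℝ] ℝ :=
  Sum.elim hingeCoef fun p => tentCoef p.1 p.2

/-- Bounds for the coefficients of the expansion. -/
def schauderWeight : SchauderIndex → ℝ := Sum.elim (fun _ => 1) fun p => (1 / 2) ^ p.1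

/-- The indices used in the `N`-th partial sum. -/
def schauderFinset (N : ℕ) : Finset SchauderIndex :=
  (Finset.Ico (-(N : ℤ)) N).disjSum
    ((Finset.range N).sigma fun k => Finset.Ico (-(N * 2 ^ k : ℤ)) (N * 2 ^ k))

/-! ### Partial sums of the expansion -/

theorem schauderWeight_nonneg (i : SchauderIndex) : 0 ≤ schauderWeight i := by
  rcases i with i | p
  · exact zero_le_one
  · exact pow_nonneg (by norm_num) _

theorem abs_schauderCoef_le (i : SchauderIndex) (f : LipSpace) :
    |schauderCoef i f| ≤ schauderWeight i * ‖f‖ := by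
  rcases i with i | p
  · simpa [schauderCoef, schauderWeight] using abs_hingeCoef_le i f
  · exact abs_tentCoef_le p.1 p.2 f

theorem tendsto_schauderFinset : Filter.Tendsto schauderFinset Filter.atTop Filter.atTop := by
  refine Filter.tendsto_atTop_finset_of_monotone (fun M N hMN => ?_) fun i => ?_
  · have hz : (M : ℤ) ≤ N := by exact_mod_cast hMN
    refine Finset.disjSum_mono (Finset.Ico_subset_Ico (by omega) hz)
      (Finset.sigma_mono (Finset.range_mono hMN) fun k => ?_)
    have : (M * 2 ^ k : ℤ) ≤ N * 2 ^ k := by gcongr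
    exact Finset.Ico_subset_Ico (by omega) this
  · rcases i with i | ⟨k, j⟩
    · refine ⟨i.natAbs + 1, ?_⟩
      rw [schauderFinset, Finset.inl_mem_disjSum, Finset.mem_Ico]
      omega
    · refine ⟨k + j.natAbs + 1, ?_⟩
      rw [schauderFinset, Finset.inr_mem_disjSum, Finset.mem_sigma, Finset.mem_Ico,
        Finset.mem_range]
      refine ⟨by simp only; omega, ?_⟩
      have h1 : ((k + j.natAbs + 1 : ℕ) : ℤ) ≤ ((k + j.natAbs + 1 : ℕ) : ℤ) * 2 ^ k := by
        have : (1 : ℤ) ≤ 2 ^ k := one_le_pow₀ (by norm_num)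
        nlinarith
      have h2 : |j| < ((k + j.natAbs + 1 : ℕ) : ℤ) := by
        push_cast
        omega
      rw [abs_lt] at h2
      constructor <;> simp only <;> omega

theorem schauder_sum_apply (N : ℕ) (f : LipSpace) (x : ℝ) :
    (∑ i ∈ schauderFinset N, schauderCoef i f • schauder i) x =
      ∑ i ∈ Finset.Ico (-(N : ℤ)) N, hingeCoef i f * hinge i x +
        ∑ k ∈ Finset.range N, ∑ j ∈ Finset.Ico (-(N * 2 ^ k : ℤ)) (N * 2 ^ k),
          tentCoef k j f * tent k j x := by
  rw [← eval_apply, map_sum, schauderFinset, Finset.sum_disjSum, Finset.sum_sigma]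
  rfl

theorem schauder_sum_apply_of_abs_le (N : ℕ) (f : LipSpace) {x : ℝ} (hx : |x| ≤ N) :
    (∑ i ∈ schauderFinset N, schauderCoef i f • schauder i) x =
      interp N f x - f (-N) := by
  have h := sum_hinge_eq f (x := x) (a := -(N : ℤ)) (b := N) (by omega)
    (by push_cast; exact (abs_le.1 hx).1)
  push_cast at h
  rw [schauder_sum_apply, h, min_eq_left (abs_le.1 hx).2, interp_eq_add_sum N]
  simp_rw [fun k => sum_tent_eq (fun j => tentCoef k j f) k N hx]
  ring

/-- All hinges and tents of the partial sum are constant on each side of `[-N, N]`, so its values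
outside are those at the nearer endpoint. -/
theorem schauder_sum_apply_clamp (N : ℕ) (f : LipSpace) (x : ℝ) :
    (∑ i ∈ schauderFinset N, schauderCoef i f • schauder i) x =
      (∑ i ∈ schauderFinset N, schauderCoef i f • schauder i) (max (-N) (min N x)) := by
  have hN : (0 : ℝ) ≤ N := Nat.cast_nonneg N
  rcases le_or_gt |x| N with hx | hx
  · rw [min_eq_right (abs_le.1 hx).2, max_eq_right (abs_le.1 hx).1]
  rw [schauder_sum_apply, schauder_sum_apply]
  have hp : ∀ k : ℕ, (0 : ℝ) < 2 ^ k := fun k => by positivity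
  congr 1
  · refine Finset.sum_congr rfl fun i hi => ?_
    obtain ⟨h1, h2⟩ := Finset.mem_Ico.1 hi
    have h1' : -(N : ℝ) ≤ i := by exact_mod_cast h1
    have h2' : (i : ℝ) + 1 ≤ N := by exact_mod_cast h2
    rw [hinge_apply, hinge_apply]
    congr 1
    rcases lt_abs.1 hx with h | h
    · have hc : max (-(N : ℝ)) (min N x) = N := by rw [min_eq_left h.le, max_eq_right (by linarith)]
      rw [hc, min_eq_left (by linarith : 1 ≤ x - i), min_eq_left (by linarith : 1 ≤ (N : ℝ) - i)]
    · have hc : max (-(N : ℝ)) (min N x) = -N := by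
        rw [min_eq_right (by linarith), max_eq_left (by linarith)]
      rw [hc, min_eq_right (by linarith : x - i ≤ 1), min_eq_right (by linarith : -(N : ℝ) - i ≤ 1),
        max_eq_left (by linarith), max_eq_left (by linarith)]
  · refine Finset.sum_congr rfl fun k _ => Finset.sum_congr rfl fun j hj => ?_
    obtain ⟨h1, h2⟩ := Finset.mem_Ico.1 hj
    have h1' : -((N : ℝ) * 2 ^ k) ≤ j := by exact_mod_cast h1
    have h2' : (j : ℝ) + 1 ≤ N * 2 ^ k := by exact_mod_cast h2
    congr 1
    rcases lt_abs.1 hx with h | h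
    · rw [min_eq_left h.le, max_eq_right (by linarith), tent_eq_zero_of_ge, tent_eq_zero_of_ge]
      · linarith
      · nlinarith [mul_lt_mul_of_pos_left h (hp k)]
    · rw [min_eq_right (by linarith), max_eq_left (by linarith), tent_eq_zero_of_le,
        tent_eq_zero_of_le]
      · linarith
      · nlinarith [mul_lt_mul_of_pos_left h (hp k)]

theorem abs_sub_schauder_sum_le_of_abs_le (N : ℕ) (f : LipSpace) {x : ℝ} (hx : |x| ≤ N) :
    |f x - (∑ i ∈ schauderFinset N, schauderCoef i f • schauder i) x - f (-N)| ≤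
      f.lip * (1 / 2) ^ N := by
  rw [schauder_sum_apply_of_abs_le N f hx]
  have : f x - (interp N f x - f (-N)) - f (-N) = f x - interp N f x := by ring
  rw [this]
  exact abs_sub_interp_le N f x

/-- A majorant independent of `N`, needed for dominated convergence: with `y` the clamped point, the
error at `y` is at most `f.lip`, and moving from `x` to `y` costs at most `f.lip * |x|`. -/
theorem abs_sub_schauder_sum_le (N : ℕ) (f : LipSpace) (x : ℝ) :
    |f x - (∑ i ∈ schauderFinset N, schauderCoef i f • schauder i) x - f (-N)| ≤
      f.lip * (1 + |x|) := by
  have hN : (0 : ℝ) ≤ N := Nat.cast_nonneg N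
  set y : ℝ := max (-N) (min N x) with hy
  have hyN : |y| ≤ N := abs_clamp_le hN
  have hxy : |x - y| ≤ |x| := by
    rcases le_or_gt |x| N with hx | hx
    · rw [hy, min_eq_right (abs_le.1 hx).2, max_eq_right (abs_le.1 hx).1, sub_self, abs_zero]
      exact abs_nonneg x
    · rcases lt_abs.1 hx with h | h
      · rw [hy, min_eq_left h.le, max_eq_right (by linarith), abs_of_nonneg (by linarith),
          abs_of_nonneg (by linarith)]
        linarith
      · rw [hy, min_eq_right (by linarith), max_eq_left (by linarith),
          abs_of_nonpos (by linarith), abs_of_nonpos (by linarith)]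
        linarith
  have h1 := abs_sub_schauder_sum_le_of_abs_le N f hyN
  have h2 := f.abs_sub_le_lip x y
  have h3 : f.lip * (1 / 2) ^ N ≤ f.lip :=
    mul_le_of_le_one_right f.lip_nonneg (pow_le_one₀ (by norm_num) (by norm_num))
  have h4 := mul_le_mul_of_nonneg_left hxy f.lip_nonneg
  rw [schauder_sum_apply_clamp, ← hy]
  rw [abs_le] at *
  constructor <;> linarith [h1.1, h1.2, h2.1, h2.2]

end LipSpace

/-! ### Summability and convergence of the expansion for the covariance seminorm -/

theorem sqrt_sqrt_pow_four {x : ℝ} (hx : 0 ≤ x) : √(√x) ^ 4 = x := by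
  rw [show (4 : ℕ) = 2 * 2 from rfl, pow_mul, Real.sq_sqrt (Real.sqrt_nonneg _), Real.sq_sqrt hx]

theorem sqrt_sqrt_mul {x : ℝ} (hx : 0 ≤ x) (y : ℝ) : √(√(x * y)) = √(√x) * √(√y) := by
  rw [Real.sqrt_mul hx, Real.sqrt_mul (Real.sqrt_nonneg _)]

theorem sqrt_sqrt_pow {x : ℝ} (hx : 0 ≤ x) (k : ℕ) : √(√(x ^ k)) = √(√x) ^ k := by
  induction k with
  | zero => simp
  | succ k ih => rw [pow_succ, sqrt_sqrt_mul (pow_nonneg hx k), ih, pow_succ]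

theorem sqrt_sqrt_rpow_neg {x : ℝ} (hx : 0 ≤ x) (s : ℝ) : √(√(x ^ (-s))) = x ^ (-(s / 4)) := by
  rw [Real.sqrt_eq_rpow, Real.sqrt_eq_rpow, ← Real.rpow_mul hx, ← Real.rpow_mul hx]
  ring_nf

theorem summable_one_add_abs_int_rpow {s : ℝ} (hs : 1 < s) :
    Summable fun i : ℤ => (1 + |(i : ℝ)|) ^ (-s) := by
  refine Summable.of_nonneg_of_le (fun i => by positivity) (fun i => ?_)
    ((Real.summable_one_div_int_add_rpow (1 / 2) s).2 hs)
  have h0 : 0 < |(i : ℝ) + 1 / 2| := by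
    rw [abs_pos]
    intro h
    have h2 : ((2 * i + 1 : ℤ) : ℝ) = 0 := by
      push_cast
      linarith
    have h3 : (2 * i + 1 : ℤ) = 0 := by exact_mod_cast h2
    omega
  rw [Real.rpow_neg (by positivity), one_div]
  refine inv_anti₀ (by positivity) (Real.rpow_le_rpow h0.le ?_ (by linarith))
  refine (abs_add_le _ _).trans ?_
  rw [abs_of_nonneg (by norm_num : (0 : ℝ) ≤ 1 / 2)]
  linarith

/-- Jensen's inequality for the fourth power. With `N = 2ᵏ` it produces the gain `2^(-k/4)` that
makes the tent series converge over all levels. -/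
theorem sum_sqrt_sqrt_div_le {N : ℕ} (hN : 0 < N) {p : Fin N → ℝ} (hp : ∀ r, 0 ≤ p r) {T : ℝ}
    (hT : ∑ r, p r ≤ T) : ∑ r, (N : ℝ)⁻¹ * √(√(p r)) ≤ √(√((N : ℝ)⁻¹ * T)) := by
  have hN' : (0 : ℝ) < N := Nat.cast_pos.2 hN
  have hT0 : 0 ≤ T := (Finset.sum_nonneg fun r _ => hp r).trans hT
  have h := pow_sum_div_card_le_sum_pow (s := Finset.univ) (f := fun r => √(√(p r)))
    (fun r _ => Real.sqrt_nonneg _) 3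
  simp only [Finset.card_univ, Fintype.card_fin] at h
  simp_rw [show 3 + 1 = 4 from rfl, fun r => sqrt_sqrt_pow_four (hp r)] at h
  rw [← Finset.mul_sum]
  refine le_of_pow_le_pow_left₀ (n := 4) (by norm_num) (Real.sqrt_nonneg _) ?_
  rw [sqrt_sqrt_pow_four (by positivity), mul_pow]
  have h2 := (div_le_iff₀ (by positivity)).1 (h.trans hT)
  calc ((N : ℝ)⁻¹) ^ 4 * (∑ r, √(√(p r))) ^ 4 ≤ ((N : ℝ)⁻¹) ^ 4 * (T * (N : ℝ) ^ 3) := by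
        gcongr
    _ = _ := by field_simp

namespace HasIntegrableCovarianceBound

open LipSpace

variable {Ω : Type*} [MeasurableSpace Ω] {d : ℕ} {P : Measure Ω} [IsProbabilityMeasure P]
  {X : EuclideanSpace ℝ (Fin d) → Ω → ℝ} {ρ : EuclideanSpace ℝ (Fin d) → ℝ}

theorem sqrt_asymCov_self_le (H : HasIntegrableCovarianceBound P X ρ) (f : LipSpace) {c T : ℝ}
    (hT : ∫ ω, (f (X 0 ω) - c) ^ 4 ∂P ≤ T) :
    √(asymCov P X f f) ≤ √((∫ t, ρ t) * √2) * √(√T) := by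
  have hR : 0 ≤ ∫ t, ρ t := integral_nonneg H.nonneg
  rw [← Real.sqrt_mul (by positivity), mul_assoc, ← Real.sqrt_mul zero_le_two]
  refine Real.sqrt_le_sqrt ((H.asymCov_self_le f c).trans ?_)
  gcongr

theorem integral_pow_four_le_measureReal (H : HasIntegrableCovarianceBound P X ρ) (f : LipSpace)
    {c : ℝ} {s : Set ℝ} (hs : MeasurableSet s) (h1 : ∀ x, |f x - c| ≤ 1)
    (h0 : ∀ x, x ∉ s → f x = c) :
    ∫ ω, (f (X 0 ω) - c) ^ 4 ∂P ≤ P.real (X 0 ⁻¹' s) := by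
  have hm : MeasurableSet (X 0 ⁻¹' s) := H.measurable_apply 0 hs
  rw [← integral_indicator_one hm]
  refine integral_mono (integrable_pow_four ((H.memLp_comp f 0).sub (memLp_const c)))
    ((integrable_const (1 : ℝ)).indicator hm) fun ω => ?_
  by_cases hω : X 0 ω ∈ s
  · rw [Set.indicator_of_mem (by exact hω), Pi.one_apply]
    have := pow_le_one₀ (n := 4) (abs_nonneg _) (h1 (X 0 ω))
    rwa [Even.pow_abs (by decide)] at this
  · rw [Set.indicator_of_notMem (by exact hω), h0 _ hω]
    simp

omit [IsProbabilityMeasure P] in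
-- Markov's inequality for the `δ`-th moment of `2 + |X 0|`. The event is `|X 0| ≥ |i| - 1`, which
-- contains `X 0 ∈ [i, i + 1)` for either sign of `i`.
theorem exists_tail_bound [IsFiniteMeasure P] (H : HasIntegrableCovarianceBound P X ρ)
    {δ : ℝ} (hδ : 0 < δ)
    (hmom : Integrable (fun ω => |X 0 ω| ^ δ) P) :
    ∃ M : ℝ, 0 ≤ M ∧ ∀ i : ℤ, P.real (X 0 ⁻¹' {x | 1 + |(i : ℝ)| ≤ 2 + |x|}) ≤
      M * (1 + |(i : ℝ)|) ^ (-δ) := by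
  have hp0 : ENNReal.ofReal δ ≠ 0 := by simpa using hδ
  have hpδ : (ENNReal.ofReal δ).toReal = δ := ENNReal.toReal_ofReal hδ.le
  have hX : AEStronglyMeasurable (X 0) P := (H.measurable_apply 0).aestronglyMeasurable
  have h1 : MemLp (X 0) (ENNReal.ofReal δ) P := by
    rw [← integrable_norm_rpow_iff hX hp0 ENNReal.ofReal_ne_top, hpδ]
    exact hmom
  have h2 : MemLp (fun ω => 2 + |X 0 ω|) (ENNReal.ofReal δ) P := (memLp_const (2 : ℝ)).add h1.norm
  have h3 : Integrable (fun ω => (2 + |X 0 ω|) ^ δ) P := by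
    have := h2.integrable_norm_rpow hp0 ENNReal.ofReal_ne_top
    rw [hpδ] at this
    refine this.congr (Filter.Eventually.of_forall fun ω => ?_)
    simp only
    rw [Real.norm_of_nonneg (by positivity)]
  refine ⟨∫ ω, (2 + |X 0 ω|) ^ δ ∂P, integral_nonneg fun ω => by positivity, fun i => ?_⟩
  have hi : (0 : ℝ) < 1 + |(i : ℝ)| := by positivity
  have h4 := mul_meas_ge_le_integral_of_nonneg
    (Filter.Eventually.of_forall fun ω => by positivity) h3 ((1 + |(i : ℝ)|) ^ δ)
  have h5 : {ω | (1 + |(i : ℝ)|) ^ δ ≤ (2 + |X 0 ω|) ^ δ} =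
      X 0 ⁻¹' {x | 1 + |(i : ℝ)| ≤ 2 + |x|} := by
    ext ω
    exact Real.rpow_le_rpow_iff hi.le (by positivity) hδ
  rw [h5] at h4
  rw [Real.rpow_neg hi.le, ← div_eq_mul_inv, le_div_iff₀ (by positivity), mul_comm]
  exact h4

theorem summable_hinge (H : HasIntegrableCovarianceBound P X ρ) {δ : ℝ} (hδ : 4 < δ)
    (hmom : Integrable (fun ω => |X 0 ω| ^ δ) P) :
    Summable fun i : ℤ => √(asymCov P X (hinge i) (hinge i)) := by
  obtain ⟨M, hM, htail⟩ := H.exists_tail_bound (by linarith) hmom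
  refine Summable.of_nonneg_of_le (fun i => Real.sqrt_nonneg _) (fun i => ?_)
    (((summable_one_add_abs_int_rpow (s := δ / 4) (by linarith)).mul_left
      (√(√M))).mul_left (√((∫ t, ρ t) * √2)))
  have hms : MeasurableSet {x : ℝ | 1 + |(i : ℝ)| ≤ 2 + |x|} :=
    measurableSet_le measurable_const (by fun_prop)
  have hbd : ∀ x, 0 ≤ hinge i x ∧ hinge i x ≤ 1 := fun x =>
    ⟨le_max_left _ _, max_le zero_le_one (min_le_left _ _)⟩
  -- A hinge with `i ≥ 0` differs from `0`, and one with `i < 0` differs from `1`, only on the tail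
  -- event.
  have h1 : ∃ c, ∫ ω, (hinge i (X 0 ω) - c) ^ 4 ∂P ≤
      P.real (X 0 ⁻¹' {x | 1 + |(i : ℝ)| ≤ 2 + |x|}) := by
    rcases le_or_gt 0 i with hi | hi
    · have hi' : (0 : ℝ) ≤ i := by exact_mod_cast hi
      refine ⟨0, H.integral_pow_four_le_measureReal _ hms (fun x => ?_) fun x hx => ?_⟩
      · rw [sub_zero, abs_of_nonneg (hbd x).1]
        exact (hbd x).2
      · simp only [Set.mem_ofPred_eq, not_le, abs_of_nonneg hi'] at hx
        rw [hinge_apply, max_eq_left]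
        exact (min_le_right _ _).trans (by linarith [le_abs_self x])
    · have hi' : (i : ℝ) + 1 ≤ 0 := by exact_mod_cast hi
      refine ⟨1, H.integral_pow_four_le_measureReal _ hms (fun x => ?_) fun x hx => ?_⟩
      · rw [abs_le]
        constructor <;> linarith [(hbd x).1, (hbd x).2]
      · simp only [Set.mem_ofPred_eq, not_le, abs_of_nonpos (by linarith : (i : ℝ) ≤ 0)] at hx
        rw [hinge_apply, min_eq_left (by linarith [neg_abs_le x]), max_eq_right zero_le_one]
  obtain ⟨c, hc⟩ := h1
  refine (H.sqrt_asymCov_self_le (hinge i) (hc.trans (htail i))).trans (le_of_eq ?_)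
  have hpos : (0 : ℝ) < 1 + |(i : ℝ)| := by positivity
  rw [sqrt_sqrt_mul hM, sqrt_sqrt_rpow_neg hpos.le]

/-- The `2ᵏ` dyadic cells inside `[i, i + 1)` are disjoint, and on their union `|i| ≤ |X 0| + 1`. -/
theorem measureReal_dyadic_block_le (H : HasIntegrableCovarianceBound P X ρ) (k : ℕ) (i : ℤ) :
    ∑ r : Fin (2 ^ k), P.real (X 0 ⁻¹' {x | ⌊2 ^ k * x⌋ = i * (2 ^ k : ℕ) + (r : ℕ)}) ≤
      P.real (X 0 ⁻¹' {x | 1 + |(i : ℝ)| ≤ 2 + |x|}) := by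
  have hm : ∀ r : Fin (2 ^ k),
      MeasurableSet (X 0 ⁻¹' {x | ⌊2 ^ k * x⌋ = i * (2 ^ k : ℕ) + (r : ℕ)}) := fun r =>
    H.measurable_apply 0 (measurableSet_eq_fun
      (Int.measurable_floor.comp (measurable_const_mul ((2 : ℝ) ^ k))) measurable_const)
  rw [← measureReal_iUnion_fintype ?_ hm]
  · refine measureReal_mono (Set.iUnion_subset fun r ω hω => ?_)
    simp only [Set.mem_preimage, Set.mem_ofPred_eq] at hω ⊢
    obtain ⟨h1, h2⟩ := Int.floor_eq_iff.1 hω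
    have hp : (0 : ℝ) < 2 ^ k := by positivity
    have hr : ((r : ℕ) : ℝ) + 1 ≤ 2 ^ k := by exact_mod_cast r.2
    have hr0 : (0 : ℝ) ≤ (r : ℕ) := Nat.cast_nonneg _
    push_cast at h1 h2
    have h3 : (i : ℝ) ≤ X 0 ω := by
      by_contra h
      push Not at h
      nlinarith [mul_lt_mul_of_pos_left h hp]
    have h4 : X 0 ω < i + 1 := by
      by_contra h
      push Not at h
      nlinarith [mul_le_mul_of_nonneg_left h hp.le]
    have h5 : |(i : ℝ)| ≤ |X 0 ω| + 1 := by
      rw [abs_le]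
      constructor <;> linarith [neg_abs_le (X 0 ω), le_abs_self (X 0 ω)]
    linarith
  · intro r r' hrr'
    refine Set.disjoint_left.2 fun ω h1 h2 => hrr' ?_
    simp only [Set.mem_preimage, Set.mem_ofPred_eq] at h1 h2
    have : ((r : ℕ) : ℤ) = (r' : ℕ) := by linarith
    exact Fin.ext (by exact_mod_cast this)

theorem summable_tent (H : HasIntegrableCovarianceBound P X ρ) {δ : ℝ} (hδ : 4 < δ)
    (hmom : Integrable (fun ω => |X 0 ω| ^ δ) P) :
    Summable fun p : Σ _ : ℕ, ℤ =>
      (1 / 2 : ℝ) ^ p.1 * √(asymCov P X (tent p.1 p.2) (tent p.1 p.2)) := by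
  obtain ⟨M, hM, htail⟩ := H.exists_tail_bound (by linarith) hmom
  set q : ℕ → ℤ → ℝ := fun k j => P.real (X 0 ⁻¹' {x | ⌊2 ^ k * x⌋ = j}) with hq
  -- Cells are grouped as `j = i * 2ᵏ + r`: Jensen's inequality sums over `r`, leaving a geometric
  -- series in `k` times a series in `i` with exponent `δ/4 > 1`.
  have hblock : Summable fun p : Σ a : ℕ × ℤ, Fin (2 ^ a.1) =>
      (((2 ^ p.1.1 : ℕ) : ℝ))⁻¹ * √(√(q p.1.1 (p.1.2 * (2 ^ p.1.1 : ℕ) + (p.2 : ℕ)))) := by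
    rw [summable_sigma_of_nonneg fun p => by positivity]
    refine ⟨fun a => Summable.of_finite, ?_⟩
    have hρ : √(√(1 / 2 : ℝ)) < 1 := by
      rw [Real.sqrt_lt' one_pos, one_pow, Real.sqrt_lt' one_pos]
      norm_num
    refine Summable.of_nonneg_of_le (fun a => tsum_nonneg fun r => by positivity) (fun a => ?_)
      ((Summable.mul_of_nonneg (summable_geometric_of_lt_one (Real.sqrt_nonneg _) hρ)
        (summable_one_add_abs_int_rpow (s := δ / 4) (by linarith))
        (fun k => pow_nonneg (Real.sqrt_nonneg _) k) (fun i => by positivity)).mul_left (√(√M)))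
    rw [tsum_fintype]
    refine (sum_sqrt_sqrt_div_le (by positivity) (fun r => measureReal_nonneg)
      ((H.measureReal_dyadic_block_le a.1 a.2).trans (htail a.2))).trans (le_of_eq ?_)
    have hpos : (0 : ℝ) < 1 + |(a.2 : ℝ)| := by positivity
    have e1 : (((2 ^ a.1 : ℕ) : ℝ))⁻¹ = (1 / 2) ^ a.1 := by
      push_cast
      rw [one_div_pow, one_div]
    rw [e1, sqrt_sqrt_mul (by positivity), sqrt_sqrt_mul hM, sqrt_sqrt_pow (by norm_num),
      sqrt_sqrt_rpow_neg hpos.le]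
    ring
  -- Division with remainder by `2ᵏ` carries summability over the triples `(k, i, r)` back to the
  -- pairs `(k, j)`.
  have hsub : Summable fun p : Σ _ : ℕ, ℤ => (1 / 2 : ℝ) ^ p.1 * √(√(q p.1 p.2)) := by
    have hinj : Function.Injective fun p : Σ _ : ℕ, ℤ =>
        (⟨(p.1, (Int.divModEquiv (2 ^ p.1) p.2).1), (Int.divModEquiv (2 ^ p.1) p.2).2⟩ :
          Σ a : ℕ × ℤ, Fin (2 ^ a.1)) := by
      rintro ⟨k, j⟩ ⟨k', j'⟩ h
      simp only [Sigma.mk.injEq, Prod.mk.injEq] at h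
      obtain ⟨⟨rfl, h1⟩, h2⟩ := h
      have h3 := (Int.divModEquiv (2 ^ k)).injective (Prod.ext h1 (eq_of_heq h2))
      rw [h3]
    refine (hblock.comp_injective hinj).congr fun p => ?_
    simp only [Function.comp_apply]
    have e : (Int.divModEquiv (2 ^ p.1) p.2).1 * ((2 ^ p.1 : ℕ) : ℤ) +
        ((Int.divModEquiv (2 ^ p.1) p.2).2 : ℕ) = p.2 :=
      (Int.divModEquiv (2 ^ p.1)).symm_apply_apply p.2
    rw [e]
    push_cast
    rw [one_div_pow, one_div]
  refine Summable.of_nonneg_of_le (fun p => by positivity) (fun p => ?_)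
    (hsub.mul_left (√((∫ t, ρ t) * √2)))
  have h1 : ∫ ω, (tent p.1 p.2 (X 0 ω) - 0) ^ 4 ∂P ≤ q p.1 p.2 := by
    refine H.integral_pow_four_le_measureReal _ ?_ (fun x => ?_) fun x hx =>
      tent_eq_zero_of_floor_ne hx
    · exact measurableSet_eq_fun
        (Int.measurable_floor.comp (measurable_const_mul ((2 : ℝ) ^ p.1))) measurable_const
    · rw [sub_zero, abs_of_nonneg (tent_nonneg _ _ _)]
      exact tent_le_one _ _ _
  calc _ ≤ (1 / 2 : ℝ) ^ p.1 * (√((∫ t, ρ t) * √2) * √(√(q p.1 p.2))) := by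
        gcongr
        exact H.sqrt_asymCov_self_le _ h1
    _ = _ := by ring

theorem summable_schauder (H : HasIntegrableCovarianceBound P X ρ) {δ : ℝ} (hδ : 4 < δ)
    (hmom : Integrable (fun ω => |X 0 ω| ^ δ) P) :
    Summable fun i => schauderWeight i * √(H.covForm (schauder i) (schauder i)) := by
  refine Summable.sum _ ?_ ?_
  · simpa [Function.comp_def, schauderWeight, schauder, covForm_apply] using
      H.summable_hinge hδ hmom
  · exact H.summable_tent hδ hmom

/-- Partial sums recover `f - f (-N)` rather than `f`; the constant is absorbed by the choice `c = f
(-N)` in `asymCov_self_le`, and the fourth moment of the remaining error vanishes by dominated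
convergence. -/
theorem tendsto_covForm_sub_schauder (H : HasIntegrableCovarianceBound P X ρ) (f : LipSpace) :
    Filter.Tendsto (fun N => H.covForm
      (f - ∑ i ∈ schauderFinset N, schauderCoef i f • schauder i)
      (f - ∑ i ∈ schauderFinset N, schauderCoef i f • schauder i)) Filter.atTop (nhds 0) := by
  set g : ℕ → LipSpace := fun N => ∑ i ∈ schauderFinset N, schauderCoef i f • schauder i with hg
  have hsub : ∀ N x, (f - g N) x = f x - g N x := fun N x => rfl
  have hint : Filter.Tendsto (fun N => ∫ ω, ((f - g N) (X 0 ω) - f (-N)) ^ 4 ∂P) Filter.atTop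
      (nhds 0) := by
    have hdom : Integrable (fun ω => (f.lip * (1 + |X 0 ω|)) ^ 4) P := by
      have h1 : MemLp (fun ω => 1 + |X 0 ω|) 4 P := (memLp_const (1 : ℝ)).add H.memLp.norm
      exact integrable_pow_four (h1.const_mul f.lip)
    have h := tendsto_integral_of_dominated_convergence
      (F := fun N ω => ((f - g N) (X 0 ω) - f (-N)) ^ 4) (f := fun _ => (0 : ℝ)) _
      (fun N => ((((f - g N).measurable.comp (H.measurable_apply 0)).sub_const
        (f (-N))).pow_const 4).aestronglyMeasurable) hdom
      (fun N => Filter.Eventually.of_forall fun ω => ?_)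
      (Filter.Eventually.of_forall fun ω => ?_)
    · simpa using h
    · rw [norm_pow, Real.norm_eq_abs, hsub]
      exact pow_le_pow_left₀ (abs_nonneg _) (abs_sub_schauder_sum_le N f (X 0 ω)) 4
    · have h0 : Filter.Tendsto (fun N : ℕ => f.lip * (1 / 2) ^ N) Filter.atTop (nhds 0) := by
        simpa using (tendsto_pow_atTop_nhds_zero_of_lt_one (r := (1 / 2 : ℝ)) (by norm_num)
          (by norm_num)).const_mul f.lip
      have h1 : Filter.Tendsto (fun N : ℕ => (f - g N) (X 0 ω) - f (-N)) Filter.atTop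
          (nhds 0) := by
        refine squeeze_zero_norm' ?_ h0
        filter_upwards [Filter.eventually_ge_atTop ⌈|X 0 ω|⌉₊] with N hN
        rw [Real.norm_eq_abs, hsub]
        exact abs_sub_schauder_sum_le_of_abs_le N f (Nat.ceil_le.1 hN)
      simpa using h1.pow 4
  have hup : Filter.Tendsto (fun N => (∫ t, ρ t) *
      √(2 * ∫ ω, ((f - g N) (X 0 ω) - f (-N)) ^ 4 ∂P)) Filter.atTop (nhds 0) := by
    have h1 := (Real.continuous_sqrt.tendsto _).comp (hint.const_mul 2)
    simpa using h1.const_mul (∫ t, ρ t)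
  exact squeeze_zero (fun N => H.asymCov_self_nonneg _) (fun N => H.asymCov_self_le _ _) hup

end HasIntegrableCovarianceBound

/-! ### The main theorem -/

theorem mainTheorem5 {Ω : Type*} [MeasurableSpace Ω] (P : Measure Ω) [IsProbabilityMeasure P]
    (d : ℕ) (hd : 1 ≤ d) (X : EuclideanSpace ℝ (Fin d) → Ω → ℝ)
    (hmeas : Measurable (fun p : EuclideanSpace ℝ (Fin d) × Ω => X p.1 p.2))
    (hstat : IsStationaryField P X)
    (n : ℕ) (δ C l : ℝ) (hδ : 4 < δ) (hC : 0 < C) (hl : 0 < l)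
    (hn : max (max (l + δ / (δ - 2)) (δ / (δ - 4))) 3 < (n : ℝ) / (d : ℝ))
    (hmix : ∀ γ r : ℝ, 2 * kappa d ≤ γ → 0 < r →
      alphaMixing P X γ r ≤ C * r ^ (-(n : ℤ)) * γ ^ l)
    (hmom : Integrable (fun ω => |X 0 ω| ^ δ) P) :
    (∀ f g : LipSpace,
      Integrable (fun t : EuclideanSpace ℝ (Fin d) =>
        cov[fun ω => f (X 0 ω), fun ω => g (X t ω); P]) volume) ∧
    (∃ (Ω' : Type) (_ : MeasurableSpace Ω') (P' : Measure Ω') (_ : IsProbabilityMeasure P')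
      (Φ : LipSpace → Ω' → ℝ), IsCenteredGaussianOn P' (asymCov P X) Φ) ∧
    (∀ (Ω' : Type*) [MeasurableSpace Ω'] (P' : Measure Ω') [IsProbabilityMeasure P']
      (Φ : LipSpace → Ω' → ℝ), IsCenteredGaussianOn P' (asymCov P X) Φ →
      ∃ Ψ : LipSpace → Ω' → ℝ, IsVersion P' Ψ Φ ∧
        ∀ ω, IsLinearMap ℝ (fun f => Ψ f ω) ∧ Continuous (fun f => Ψ f ω)) := by
  have hX : ∀ t, Measurable (X t) := fun t => hmeas.comp measurable_prodMk_left
  have hd' : (0 : ℝ) < d := by exact_mod_cast hd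
  -- `n / d > 3` is more than enough for `(1 + ‖t‖) ^ (-n/2)` to be integrable.
  have hnd : 2 * (d : ℝ) < n := by
    have h3 : (3 : ℝ) < n / d := lt_of_le_of_lt (le_max_right _ _) hn
    rw [lt_div_iff₀ hd'] at h3
    linarith
  have h4 : MemLp (X 0) 4 P := by
    have hδ0 : ENNReal.ofReal δ ≠ 0 := by
      rw [Ne, ENNReal.ofReal_eq_zero, not_le]
      linarith
    have h1 : MemLp (X 0) (ENNReal.ofReal δ) P := by
      rw [← integrable_norm_rpow_iff (hX 0).aestronglyMeasurable hδ0 ENNReal.ofReal_ne_top,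
        ENNReal.toReal_ofReal (by linarith)]
      exact hmom
    refine h1.mono_exponent ?_
    rw [← ENNReal.ofReal_ofNat]
    exact ENNReal.ofReal_le_ofReal hδ.le
  obtain ⟨ρ, hρi, hρ0, hρ⟩ := hstat.exists_integrable_covariance_bound hX hnd hmix
  have H : HasIntegrableCovarianceBound P X ρ := ⟨hmeas, hstat, h4, hρi, hρ0, hρ⟩
  refine ⟨H.integrable_covariance, ?_, ?_⟩
  · obtain ⟨Ω', mΩ', P', hP', Φ, h1, h2, h3, h4⟩ := exists_gaussianProcess_of_bilinForm H.covForm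
      H.asymCov_comm H.asymCov_self_nonneg
    exact ⟨Ω', mΩ', P', hP', Φ, h1, h2, h3, h4⟩
  · intro Ω' _ P' _ Φ hΦ
    have hΦ' : IsCenteredGaussianOn P' (fun f g => H.covForm f g) Φ := hΦ
    exact hΦ'.exists_version LipSpace.schauder LipSpace.schauderCoef LipSpace.schauderWeight
      LipSpace.schauderWeight_nonneg LipSpace.abs_schauderCoef_le
      (H.summable_schauder hδ hmom) LipSpace.schauderFinset LipSpace.tendsto_schauderFinset
      H.tendsto_covForm_sub_schauder
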